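/- **Conventions.** All categories are locally small. $\operatorname{Ext}^i$ is Yoneda Ext in an abelian category. For an abelian category $\mathsf A$ with set-indexed coproducts and $T\in\mathsf A$, let $\operatorname{Add}(T)$ be the full subcategory of direct summands of coproducts $T^{(X)}$ of copies of $T$. Call $T$ *weakly tilting* if $\operatorname{Ext}^i_{\mathsf A}(T,T^{(X)})=0$ for all sets $X$ and all $i>0$. Let $\mathsf E_{\max}(T)$ be the class of all $E\in\mathsf A$ such that $\operatorname{Ext}^i_{\mathsf A}(T,E)=0$ for all $i>0$ and there is an exact sequence $\cdots\to T_2\to T_1\to T_0\to E\to 0$ with all $T_j\in\operatorname{Add}(T)$ that remains exact after applying $\operatorname{Hom}_{\mathsf A}(T,-)$. If $\mathsf A$ is complete, cocomplete and has an injective cogenerator, $T$ is *$\infty$-tilting* if it is weakly tilting and all injective objects of $\mathsf A$ lie in $\mathsf E_{\max}(T)$. Dually, for an abelian category $\mathsf B$ with set-indexed products and $W\in\mathsf B$, let $\operatorname{Prod}(W)$ be the full subcategory of direct summands of products $W^X$ of copies of $W$. Call $W$ *weakly cotilting* if $\operatorname{Ext}^i_{\mathsf B}(W^X,W)=0$ for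 all sets $X$ and all $i>0$. Let $\mathsf F_{\max}(W)$ be the class of all $F\in\mathsf B$ such that $\operatorname{Ext}^i_{\mathsf B}(F,W)=0$ for all $i>0$ and there is an exact sequence $0\to F\to W^0\to W^1\to W^2\to\cdots$ with all $W^j\in\operatorname{Prod}(W)$ that remains exact after applying $\operatorname{Hom}_{\mathsf B}(-,W)$. If $\mathsf B$ is complete, cocomplete and has a projective generator, $W$ is *$\infty$-cotilting* if it is weakly cotilting and all projective objects of $\mathsf B$ lie in $\mathsf F_{\max}(W)$. A *tilting datum* is a triple $(\mathsf A,J,T)$, where $\mathsf A$ is a complete, cocomplete abelian category, $J$ an injective cogenerator and $T$ an $\infty$-tilting object of $\mathsf A$. A *cotilting datum* is a triple $(\mathsf B,P,W)$, where $\mathsf B$ is a complete, cocomplete abelian category, $P$ a projective generator and $W$ an $\infty$-cotilting object of $\mathsf B$. Two data of the same kind are *equivalent* if there is an equivalence of categories taking the distinguished objects of one to those of the other, up to isomorphism. *Tilting.* For a tilting datum $(\mathsf A,J,T)$, let $\sigma_T(\mathsf A)$ be the category of modules (algebras) over the monad $X\mapsto\operatorname{Hom}_{\mathsf A}(T,T^{(X)})$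 on the category of sets, and let $\Psi\colon\mathsf A\to\sigma_T(\mathsf A)$ be the functor $N\mapsto\operatorname{Hom}_{\mathsf A}(T,N)$. Write $(\mathsf A,J,T)\rightsquigarrow(\mathsf B,P,W)$ if, up to an equivalence of categories $\mathsf B\simeq\sigma_T(\mathsf A)$, one has $P\cong\Psi(T)$ and $W\cong\Psi(J)$, and $\Psi$ has a left adjoint $\Phi\colon\mathsf B\to\mathsf A$ which restricts to an equivalence from the full subcategory of projective objects of $\mathsf B$ onto $\operatorname{Add}(T)$. *Cotilting.* For a cotilting datum $(\mathsf B,P,W)$, let $\pi_W(\mathsf B)$ be the opposite of the category of modules over the monad $X\mapsto\operatorname{Hom}_{\mathsf B}(W^X,W)$ on the category of sets, and let $\Phi\colon\mathsf B\to\pi_W(\mathsf B)$ be the functor $N\mapsto\operatorname{Hom}_{\mathsf B}(N,W)$. Write $(\mathsf B,P,W)\rightsquigarrow(\mathsf A,J,T)$ if, up to an equivalence of categories $\mathsf A\simeq\pi_W(\mathsf B)$, one has $J\cong\Phi(W)$ and $T\cong\Phi(P)$, and $\Phi$ has a right adjoint $\Psi\colon\mathsf A\to\mathsf B$ which restricts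 to an equivalence from the full subcategory of injective objects of $\mathsf A$ onto $\operatorname{Prod}(W)$. **Corollary 2.5.** These two constructions are mutually inverse bijections between equivalence classes of tilting data and equivalence classes of cotilting data. That is, there is a bijection $e$ from the equivalence classes of tilting data to the equivalence classes of cotilting data such that for every tilting datum $a$ and every cotilting datum $b$, $$e([a])=[b]\iff a\rightsquigarrow b\qquad\text{and}\qquad e^{-1}([b])=[a]\iff b\rightsquigarrow a.$$ -/

import Mathlib

open CategoryTheory CategoryTheory.Limits Opposite

universe v u

noncomputable section

namespace TiltingCotilting

section Abelian

variable {C : Type u} [Category.{v} C] [Abelian C]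

/-- The vanishing of the group `Ext^i(X, Y)` in the abelian category `C`. No enough
projectives or injectives are needed: the universe of the `Ext`-groups is chosen large enough
for them to exist, and their vanishing does not depend on this choice. -/
def ExtVanishes (X Y : C) (i : ℕ) : Prop :=
  Subsingleton (@Abelian.Ext C _ _ (HasExt.standard C) X Y i)

variable (C) in
/-- The full subcategory of projective objects. -/
def projectives : ObjectProperty C := fun X => Projective X

variable (C) in
/-- The full subcategory of injective objects. -/
def injectives : ObjectProperty C := fun X => Injective X

/-- `Add(T)`: the direct summands of coproducts of copies of `T`. -/
def AddOf [HasCoproducts.{v} C] (T : C) : ObjectProperty C :=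
  fun X => ∃ I : Type v, Nonempty (Retract X (∐ fun _ : I => T))

/-- `Prod(W)`: the direct summands of products of copies of `W`. -/
def ProdOf [HasProducts.{v} C] (W : C) : ObjectProperty C :=
  fun X => ∃ I : Type v, Nonempty (Retract X (∏ᶜ fun _ : I => W))

/-- `T` is weakly tilting: `Ext^i(T, T^{(I)}) = 0` for all sets `I` and all `i > 0`. -/
def IsWeaklyTilting [HasCoproducts.{v} C] (T : C) : Prop :=
  ∀ (I : Type v) (i : ℕ), 0 < i → ExtVanishes T (∐ fun _ : I => T) i

/-- `W` is weakly cotilting: `Ext^i(W^I, W) = 0` for all sets `I` and all `i > 0`. -/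
def IsWeaklyCotilting [HasProducts.{v} C] (W : C) : Prop :=
  ∀ (I : Type v) (i : ℕ), 0 < i → ExtVanishes (∏ᶜ fun _ : I => W) W i

/-- An exact sequence `⋯ ⟶ X 2 ⟶ X 1 ⟶ X 0 ⟶ E ⟶ 0` with all `X n` in `Add(T)` which
remains exact after applying `Hom(T, -)`. -/
structure AddResolution [HasCoproducts.{v} C] (T E : C) where
  X : ℕ → C
  d : ∀ n, X (n + 1) ⟶ X n
  ε : X 0 ⟶ E
  mem_add : ∀ n, AddOf T (X n)
  d_comp_d : ∀ n, d (n + 1) ≫ d n = 0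
  d_comp_ε : d 0 ≫ ε = 0
  epi_ε : Epi ε
  exact_zero : (ShortComplex.mk (d 0) ε d_comp_ε).Exact
  exact_succ : ∀ n, (ShortComplex.mk (d (n + 1)) (d n) (d_comp_d n)).Exact
  hom_surjective : ∀ f : T ⟶ E, ∃ g : T ⟶ X 0, g ≫ ε = f
  hom_exact_zero : ∀ f : T ⟶ X 0, f ≫ ε = 0 → ∃ g : T ⟶ X 1, g ≫ d 0 = f
  hom_exact_succ : ∀ (n : ℕ) (f : T ⟶ X (n + 1)), f ≫ d n = 0 →
    ∃ g : T ⟶ X (n + 2), g ≫ d (n + 1) = f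

/-- An exact sequence `0 ⟶ F ⟶ X 0 ⟶ X 1 ⟶ X 2 ⟶ ⋯` with all `X n` in `Prod(W)` which
remains exact after applying `Hom(-, W)`. -/
structure ProdCoresolution [HasProducts.{v} C] (W F : C) where
  X : ℕ → C
  d : ∀ n, X n ⟶ X (n + 1)
  η : F ⟶ X 0
  mem_prod : ∀ n, ProdOf W (X n)
  d_comp_d : ∀ n, d n ≫ d (n + 1) = 0
  η_comp_d : η ≫ d 0 = 0
  mono_η : Mono η
  exact_zero : (ShortComplex.mk η (d 0) η_comp_d).Exact
  exact_succ : ∀ n, (ShortComplex.mk (d n) (d (n + 1)) (d_comp_d n)).Exact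
  hom_surjective : ∀ f : F ⟶ W, ∃ g : X 0 ⟶ W, η ≫ g = f
  hom_exact_zero : ∀ f : X 0 ⟶ W, η ≫ f = 0 → ∃ g : X 1 ⟶ W, d 0 ≫ g = f
  hom_exact_succ : ∀ (n : ℕ) (f : X (n + 1) ⟶ W), d n ≫ f = 0 →
    ∃ g : X (n + 2) ⟶ W, d (n + 1) ≫ g = f

/-- The class `E_max(T)`. -/
def EMax [HasCoproducts.{v} C] (T : C) : ObjectProperty C :=
  fun E => (∀ i : ℕ, 0 < i → ExtVanishes T E i) ∧ Nonempty (AddResolution T E)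

/-- The class `F_max(W)`. -/
def FMax [HasProducts.{v} C] (W : C) : ObjectProperty C :=
  fun F => (∀ i : ℕ, 0 < i → ExtVanishes F W i) ∧ Nonempty (ProdCoresolution W F)

/-- `T` is `∞`-tilting: it is weakly tilting and all injectives lie in `E_max(T)`. -/
def IsInftyTilting [HasCoproducts.{v} C] (T : C) : Prop :=
  IsWeaklyTilting T ∧ injectives C ≤ EMax T

/-- `W` is `∞`-cotilting: it is weakly cotilting and all projectives lie in `F_max(W)`. -/
def IsInftyCotilting [HasProducts.{v} C] (W : C) : Prop :=
  IsWeaklyCotilting W ∧ projectives C ≤ FMax W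

/-- `σ_T(C)`: the category of modules (algebras) over the monad `X ↦ Hom(T, T^{(X)})` on the
category of sets. The monad is the one of the adjunction between `X ↦ T^{(X)}` and
`Hom(T, -)`. -/
abbrev SigmaCat [HasCoproducts.{v} C] (T : C) : Type (v + 1) :=
  (sigmaConstAdj.{v} T).toMonad.Algebra

/-- The functor `Hom(T, -) : C ⥤ σ_T(C)`. -/
abbrev homFunctor [HasCoproducts.{v} C] (T : C) : C ⥤ SigmaCat T :=
  Monad.comparison (sigmaConstAdj.{v} T)

/-- `π_W(C)`: the opposite of the category of modules (algebras) over the monad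
`X ↦ Hom(W^X, W)` on the category of sets. The monad is the one of the adjunction between
`X ↦ W^X` and `Hom(-, W)`. -/
abbrev PiCat [HasProducts.{v} C] (W : C) : Type (v + 1) :=
  (piConstAdj.{v} W).toMonad.Algebraᵒᵖ

/-- The functor `Hom(-, W) : C ⥤ π_W(C)`. -/
abbrev cohomFunctor [HasProducts.{v} C] (W : C) : C ⥤ PiCat W :=
  (Monad.comparison (piConstAdj.{v} W)).rightOp

end Abelian

/-- The functor `F` restricts to an equivalence between the full subcategory `P` of its source
and the full subcategory `Q` of its target. -/
structure Identifies {C D : Type*} [Category* C] [Category* D] (F : C ⥤ D)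
    (P : ObjectProperty C) (Q : ObjectProperty D) : Prop where
  full : (P.ι ⋙ F).Full
  faithful : (P.ι ⋙ F).Faithful
  mem_iff : ∀ Y : D, Q Y ↔ ∃ X : C, P X ∧ Nonempty (F.obj X ≅ Y)

/-- A complete, cocomplete abelian category with an injective cogenerator `J` and an
`∞`-tilting object `T`. -/
structure TiltingDatum : Type (v + 2) where
  A : Type (v + 1)
  [category : Category.{v} A]
  [abelian : Abelian A]
  [hasLimits : HasLimits A]
  [hasColimits : HasColimits A]
  J : A
  T : A
  injective : Injective J
  cogenerator : IsCoseparator J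
  tilting : IsInftyTilting T

/-- A complete, cocomplete abelian category with a projective generator `P` and an
`∞`-cotilting object `W`. -/
structure CotiltingDatum : Type (v + 2) where
  B : Type (v + 1)
  [category : Category.{v} B]
  [abelian : Abelian B]
  [hasLimits : HasLimits B]
  [hasColimits : HasColimits B]
  P : B
  W : B
  projective : Projective P
  generator : IsSeparator P
  cotilting : IsInftyCotilting W

attribute [instance] TiltingDatum.category TiltingDatum.abelian TiltingDatum.hasLimits
  TiltingDatum.hasColimits CotiltingDatum.category CotiltingDatum.abelian
  CotiltingDatum.hasLimits CotiltingDatum.hasColimits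

/-- Data are equivalent if there is an equivalence of categories matching the distinguished
objects up to isomorphism. -/
instance TiltingDatum.setoid : Setoid TiltingDatum.{v} where
  r a a' := ∃ G : a.A ≌ a'.A,
    Nonempty (G.functor.obj a.J ≅ a'.J) ∧ Nonempty (G.functor.obj a.T ≅ a'.T)
  iseqv :=
    { refl := fun a => ⟨CategoryTheory.Equivalence.refl, ⟨Iso.refl _⟩, ⟨Iso.refl _⟩⟩
      symm := by
        rintro a a' ⟨G, ⟨i⟩, ⟨j⟩⟩
        exact ⟨G.symm, ⟨G.inverse.mapIso i.symm ≪≫ (G.unitIso.app _).symm⟩,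
          ⟨G.inverse.mapIso j.symm ≪≫ (G.unitIso.app _).symm⟩⟩
      trans := by
        rintro a a' a'' ⟨G, ⟨i⟩, ⟨j⟩⟩ ⟨G', ⟨i'⟩, ⟨j'⟩⟩
        exact ⟨G.trans G', ⟨G'.functor.mapIso i ≪≫ i'⟩, ⟨G'.functor.mapIso j ≪≫ j'⟩⟩ }

/-- Data are equivalent if there is an equivalence of categories matching the distinguished
objects up to isomorphism. -/
instance CotiltingDatum.setoid : Setoid CotiltingDatum.{v} where
  r b b' := ∃ G : b.B ≌ b'.B,
    Nonempty (G.functor.obj b.P ≅ b'.P) ∧ Nonempty (G.functor.obj b.W ≅ b'.W)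
  iseqv :=
    { refl := fun a => ⟨CategoryTheory.Equivalence.refl, ⟨Iso.refl _⟩, ⟨Iso.refl _⟩⟩
      symm := by
        rintro a a' ⟨G, ⟨i⟩, ⟨j⟩⟩
        exact ⟨G.symm, ⟨G.inverse.mapIso i.symm ≪≫ (G.unitIso.app _).symm⟩,
          ⟨G.inverse.mapIso j.symm ≪≫ (G.unitIso.app _).symm⟩⟩
      trans := by
        rintro a a' a'' ⟨G, ⟨i⟩, ⟨j⟩⟩ ⟨G', ⟨i'⟩, ⟨j'⟩⟩
        exact ⟨G.trans G', ⟨G'.functor.mapIso i ≪≫ i'⟩, ⟨G'.functor.mapIso j ≪≫ j'⟩⟩ }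

/-- `(B, P, W)` is, up to equivalence, obtained from `(A, J, T)` as follows: `B = σ_T(A)`,
`Ψ = Hom(T, -) : A ⥤ B`, and the left adjoint `Φ : B ⥤ A` of `Ψ` identifies the projective
objects of `B` with `Add(T)`; moreover `P = Ψ(T)` and `W = Ψ(J)`. -/
def TiltsTo (a : TiltingDatum.{v}) (b : CotiltingDatum.{v}) : Prop :=
  ∃ (Φ : b.B ⥤ a.A) (Ψ : a.A ⥤ b.B) (E : b.B ≌ SigmaCat a.T),
    Nonempty (Φ ⊣ Ψ) ∧
    Nonempty (Ψ ⋙ E.functor ≅ homFunctor a.T) ∧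
    Identifies Φ (projectives b.B) (AddOf a.T) ∧
    Nonempty (b.P ≅ Ψ.obj a.T) ∧
    Nonempty (b.W ≅ Ψ.obj a.J)

/-- `(A, J, T)` is, up to equivalence, obtained from `(B, P, W)` as follows: `A = π_W(B)`,
`Φ = Hom(-, W) : B ⥤ A`, and the right adjoint `Ψ : A ⥤ B` of `Φ` identifies the injective
objects of `A` with `Prod(W)`; moreover `J = Φ(W)` and `T = Φ(P)`. -/
def CotiltsTo (b : CotiltingDatum.{v}) (a : TiltingDatum.{v}) : Prop :=
  ∃ (Ψ : a.A ⥤ b.B) (Φ : b.B ⥤ a.A) (E : a.A ≌ PiCat b.W),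
    Nonempty (Φ ⊣ Ψ) ∧
    Nonempty (Φ ⋙ E.functor ≅ cohomFunctor b.W) ∧
    Identifies Ψ (injectives a.A) (ProdOf b.W) ∧
    Nonempty (a.J ≅ Φ.obj b.W) ∧
    Nonempty (a.T ≅ Φ.obj b.P)

end TiltingCotilting

end

/-! Both relations are shown to equal one self-dual relation, `Corresponds`: an adjunction Φ ⊣ Ψ
with unit invertible on the projectives of B, counit invertible on the injectives of A, T ≅ Φ(P) and
W ≅ Ψ(J). Passing to opposite categories swaps unit with counit and tilting with cotilting
(`corresponds_op_iff`), so each statement is needed on one side only.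

A tilting step gives this relation because injectives have Add(T)-resolutions that survive Hom(T,
-), and this forces the counit to be invertible on them (`isIso_counit_of_addResolution`).
Conversely, Hom(P, Ψ(-)) ≅ Hom(T, -) identifies the monads of P and T, and B is equivalent to the
algebras over the monad of its projective generator P (`isEquivalence_homFunctor`). Hence B ≃ σ_T(A)
compatibly with Ψ, which also makes (B, P, W) unique up to equivalence (`Corresponds.equiv_right`).

For existence, the groups Hom(T, T^(X)) make σ_T(A) a complete and cocomplete abelian category with
the free algebra on one generator as projective generator. There Ψ(J) is ∞-cotilting
(`isInftyCotilting`): Ψ turns Add(T)-resolutions of powers of J into projective resolutions, and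
coresolutions of Φ(Q) by powers of J into Prod(W)-coresolutions of Q. In both cases maps into Ψ(J)
become maps into J, where injectivity gives exactness. -/

noncomputable section

namespace TiltingCotilting

/-! ### Vanishing of Ext by dimension shifting -/

section Ext

variable {C : Type u} [Category.{v} C] [Abelian C]

open Abelian

lemma extVanishes_iff {X Y : C} {i : ℕ} :
    ExtVanishes X Y i ↔ ∀ x : @Abelian.Ext C _ _ (HasExt.standard C) X Y i, x = 0 := by
  let := HasExt.standard C
  refine ⟨fun h x => ?_, fun h => ?_⟩
  · have : Subsingleton (Abelian.Ext X Y i) := h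
    exact Subsingleton.elim _ _
  · exact ⟨fun x y => (h x).trans (h y).symm⟩

lemma extVanishes_of_projective (X Y : C) [Projective X] {i : ℕ} (hi : 0 < i) :
    ExtVanishes X Y i := by
  let := HasExt.standard C
  obtain ⟨i, rfl⟩ := Nat.exists_eq_succ_of_ne_zero hi.ne'
  exact Ext.subsingleton_of_projective X Y i

lemma extVanishes_of_injective (X Y : C) [Injective Y] {i : ℕ} (hi : 0 < i) :
    ExtVanishes X Y i := by
  let := HasExt.standard C
  obtain ⟨i, rfl⟩ := Nat.exists_eq_succ_of_ne_zero hi.ne'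
  exact Ext.subsingleton_of_injective X Y i

/-- Composing with the two retractions makes Ext^i(X, Y) a retract of Ext^i(X', Y'). -/
lemma ExtVanishes.of_retract {X X' Y Y' : C} (r : Retract X X') (s : Retract Y Y') {i : ℕ}
    (h : ExtVanishes X' Y' i) : ExtVanishes X Y i := by
  let := HasExt.standard C
  rw [extVanishes_iff] at h ⊢
  intro x
  have hx := h ((Ext.mk₀ r.r).comp (x.comp (Ext.mk₀ s.i) (add_zero i)) (zero_add i))
  have key : (Ext.mk₀ r.i).comp (((Ext.mk₀ r.r).comp (x.comp (Ext.mk₀ s.i) (add_zero i))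
      (zero_add i)).comp (Ext.mk₀ s.r) (add_zero i)) (zero_add i) = x := by
    rw [Ext.comp_assoc_of_third_deg_zero, Ext.mk₀_comp_mk₀_assoc, r.retract, Ext.mk₀_id_comp,
      Ext.comp_assoc_of_third_deg_zero, Ext.mk₀_comp_mk₀, s.retract, Ext.comp_mk₀_id]
  rw [← key, hx, Ext.zero_comp, Ext.comp_zero]

/-- By the long exact sequence, Ext^1(X₃, Y) is the cokernel of Hom(X₂, Y) → Hom(X₁, Y). This
expresses vanishing through morphisms alone, a form that transfers to the opposite category. -/
lemma extVanishes_one_iff_of_projective {S : ShortComplex C} (hS : S.ShortExact)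
    [Projective S.X₂] (Y : C) :
    ExtVanishes S.X₃ Y 1 ↔ ∀ f : S.X₁ ⟶ Y, ∃ g, S.f ≫ g = f := by
  let := HasExt.standard C
  rw [extVanishes_iff]
  constructor
  · intro h f
    obtain ⟨x, hx⟩ := Ext.contravariant_sequence_exact₁ hS Y (Ext.mk₀ f) (add_zero 1) (h _)
    obtain ⟨g, rfl⟩ := (Ext.mk₀_bijective _ _).surjective x
    exact ⟨g, (Ext.mk₀_bijective _ _).injective (by rwa [Ext.mk₀_comp_mk₀] at hx)⟩
  · intro h x
    obtain ⟨y, rfl⟩ := Ext.contravariant_sequence_exact₃ hS Y x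
      (Ext.eq_zero_of_projective _) (add_zero 1)
    obtain ⟨f, rfl⟩ := (Ext.mk₀_bijective _ _).surjective y
    obtain ⟨g, rfl⟩ := h f
    rw [← Ext.mk₀_comp_mk₀, hS.extClass_comp_assoc]

lemma extVanishes_succ_iff_of_projective {S : ShortComplex C} (hS : S.ShortExact)
    [Projective S.X₂] (Y : C) {i : ℕ} (hi : 0 < i) :
    ExtVanishes S.X₃ Y (i + 1) ↔ ExtVanishes S.X₁ Y i := by
  let := HasExt.standard C
  obtain ⟨i, rfl⟩ := Nat.exists_eq_succ_of_ne_zero hi.ne'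
  rw [extVanishes_iff, extVanishes_iff]
  constructor
  · intro h x
    obtain ⟨y, rfl⟩ := Ext.contravariant_sequence_exact₁ hS Y x (add_comm 1 _) (h _)
    rw [Ext.eq_zero_of_projective y, Ext.comp_zero]
  · intro h x
    obtain ⟨y, rfl⟩ := Ext.contravariant_sequence_exact₃ hS Y x
      (Ext.eq_zero_of_projective _) (add_comm 1 _)
    rw [h y, Ext.comp_zero]

lemma extVanishes_one_iff_of_injective {S : ShortComplex C} (hS : S.ShortExact)
    [Injective S.X₂] (X : C) :
    ExtVanishes X S.X₁ 1 ↔ ∀ f : X ⟶ S.X₃, ∃ g, g ≫ S.g = f := by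
  let := HasExt.standard C
  rw [extVanishes_iff]
  constructor
  · intro h f
    obtain ⟨x, hx⟩ := Ext.covariant_sequence_exact₃ X hS (Ext.mk₀ f) (zero_add 1) (h _)
    obtain ⟨g, rfl⟩ := (Ext.mk₀_bijective _ _).surjective x
    exact ⟨g, (Ext.mk₀_bijective _ _).injective (by rwa [Ext.mk₀_comp_mk₀] at hx)⟩
  · intro h x
    obtain ⟨y, rfl⟩ := Ext.covariant_sequence_exact₁ X hS x
      (Ext.eq_zero_of_injective _) (zero_add 1)
    obtain ⟨f, rfl⟩ := (Ext.mk₀_bijective _ _).surjective y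
    obtain ⟨g, rfl⟩ := h f
    rw [← Ext.mk₀_comp_mk₀, Ext.comp_assoc_of_second_deg_zero, hS.comp_extClass, Ext.comp_zero]

lemma extVanishes_succ_iff_of_injective {S : ShortComplex C} (hS : S.ShortExact)
    [Injective S.X₂] (X : C) {i : ℕ} (hi : 0 < i) :
    ExtVanishes X S.X₁ (i + 1) ↔ ExtVanishes X S.X₃ i := by
  let := HasExt.standard C
  obtain ⟨i, rfl⟩ := Nat.exists_eq_succ_of_ne_zero hi.ne'
  rw [extVanishes_iff, extVanishes_iff]
  constructor
  · intro h x
    obtain ⟨y, rfl⟩ := Ext.covariant_sequence_exact₃ X hS x rfl (h _)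
    rw [Ext.eq_zero_of_injective y, Ext.zero_comp]
  · intro h x
    obtain ⟨y, rfl⟩ := Ext.covariant_sequence_exact₁ X hS x
      (Ext.eq_zero_of_injective _) rfl
    rw [h y, Ext.zero_comp]

lemma shortExact_kernel_ι {X Y : C} (f : X ⟶ Y) [Epi f] :
    (ShortComplex.mk (kernel.ι f) f (kernel.condition f)).ShortExact where
  exact := ShortComplex.exact_kernel f

lemma shortExact_cokernel_π {X Y : C} (f : X ⟶ Y) [Mono f] :
    (ShortComplex.mk f (cokernel.π f) (cokernel.condition f)).ShortExact where
  exact := ShortComplex.exact_cokernel f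

/-- A projective presentation of X is an injective copresentation of `op X`. Shifting dimensions
along it on both sides reduces to degree one, where both conditions say that maps from the syzygy to
Y extend to the projective cover term; no isomorphism of Ext groups is needed. -/
lemma extVanishes_op_iff_of_enoughProjectives [EnoughProjectives C] (Y : C) {i : ℕ}
    (hi : 0 < i) : ∀ X : C, ExtVanishes (op Y) (op X) i ↔ ExtVanishes X Y i := by
  induction i, hi using Nat.le_induction with
  | base =>
    intro X
    have hS := shortExact_kernel_ι (Projective.π X)
    have : Projective (ShortComplex.mk _ _ (kernel.condition (Projective.π X))).X₂ :=
      inferInstanceAs (Projective (Projective.over X))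
    have : Injective (ShortComplex.mk _ _ (kernel.condition (Projective.π X))).op.X₂ :=
      inferInstanceAs (Injective (op (Projective.over X)))
    refine (extVanishes_one_iff_of_injective hS.op (op Y)).trans
      (Iff.trans ?_ (extVanishes_one_iff_of_projective hS Y).symm)
    exact ⟨fun h f => (h f.op).imp' Quiver.Hom.unop fun g hg => Quiver.Hom.op_inj hg,
      fun h f => (h f.unop).imp' Quiver.Hom.op fun g hg => Quiver.Hom.unop_inj hg⟩
  | succ i hi ih =>
    intro X
    have hS := shortExact_kernel_ι (Projective.π X)
    have : Projective (ShortComplex.mk _ _ (kernel.condition (Projective.π X))).X₂ :=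
      inferInstanceAs (Projective (Projective.over X))
    have : Injective (ShortComplex.mk _ _ (kernel.condition (Projective.π X))).op.X₂ :=
      inferInstanceAs (Injective (op (Projective.over X)))
    exact (extVanishes_succ_iff_of_injective hS.op (op Y) hi).trans
      ((ih _).trans (extVanishes_succ_iff_of_projective hS Y hi).symm)

lemma extVanishes_op_iff_of_enoughInjectives [EnoughInjectives C] (X : C) {i : ℕ}
    (hi : 0 < i) : ∀ Y : C, ExtVanishes (op Y) (op X) i ↔ ExtVanishes X Y i := by
  induction i, hi using Nat.le_induction with
  | base =>
    intro Y
    have hS := shortExact_cokernel_π (Injective.ι Y)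
    have : Injective (ShortComplex.mk _ _ (cokernel.condition (Injective.ι Y))).X₂ :=
      inferInstanceAs (Injective (Injective.under Y))
    have : Projective (ShortComplex.mk _ _ (cokernel.condition (Injective.ι Y))).op.X₂ :=
      inferInstanceAs (Projective (op (Injective.under Y)))
    refine (extVanishes_one_iff_of_projective hS.op (op X)).trans
      (Iff.trans ?_ (extVanishes_one_iff_of_injective hS X).symm)
    exact ⟨fun h f => (h f.op).imp' Quiver.Hom.unop fun g hg => Quiver.Hom.op_inj hg,
      fun h f => (h f.unop).imp' Quiver.Hom.op fun g hg => Quiver.Hom.unop_inj hg⟩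
  | succ i hi ih =>
    intro Y
    have hS := shortExact_cokernel_π (Injective.ι Y)
    have : Injective (ShortComplex.mk _ _ (cokernel.condition (Injective.ι Y))).X₂ :=
      inferInstanceAs (Injective (Injective.under Y))
    have : Projective (ShortComplex.mk _ _ (cokernel.condition (Injective.ι Y))).op.X₂ :=
      inferInstanceAs (Projective (op (Injective.under Y)))
    exact (extVanishes_succ_iff_of_projective hS.op (op X) hi).trans
      ((ih _).trans (extVanishes_succ_iff_of_injective hS X hi).symm)

/-- Vanishing of `Ext` from a projective resolution that stays exact under `Hom(-, Y)`. -/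
lemma extVanishes_of_resolution (Y : C) {i : ℕ} (hi : 0 < i) :
    ∀ (E : C) (X : ℕ → C) (d : ∀ n, X (n + 1) ⟶ X n) (ε : X 0 ⟶ E)
      (_ : ∀ n, Projective (X n)) (dd : ∀ n, d (n + 1) ≫ d n = 0) (dε : d 0 ≫ ε = 0)
      (_ : Epi ε) (_ : (ShortComplex.mk (d 0) ε dε).Exact)
      (_ : ∀ n, (ShortComplex.mk (d (n + 1)) (d n) (dd n)).Exact)
      (_ : ∀ n (f : X (n + 1) ⟶ Y), d (n + 1) ≫ f = 0 → ∃ g, d n ≫ g = f),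
      ExtVanishes E Y i := by
  induction i, hi using Nat.le_induction with
  | base =>
    intro E X d ε hX dd dε hε h₀ hs hY
    have hS := shortExact_kernel_ι ε
    have : Projective (ShortComplex.mk _ _ (kernel.condition ε)).X₂ := hX 0
    refine (extVanishes_one_iff_of_projective hS Y).2 fun f => ?_
    -- A map f on the syzygy pulls back to a cocycle on `X 1`, hence comes from `X 0`; as `X 1` maps
    -- onto the syzygy, the extension restricts to f.
    obtain ⟨g, hg⟩ := hY 0 (kernel.lift ε (d 0) dε ≫ f) (by
      have : d 1 ≫ kernel.lift ε (d 0) dε = 0 := by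
        rw [← cancel_mono (kernel.ι ε)]; simp [dd]
      rw [reassoc_of% this, zero_comp])
    have : Epi (kernel.lift ε (d 0) dε) := h₀.epi_kernelLift
    exact ⟨g, by rw [← cancel_epi (kernel.lift ε (d 0) dε), ← hg]; simp⟩
  | succ i hi ih =>
    intro E X d ε hX dd dε hε h₀ hs hY
    have hS := shortExact_kernel_ι ε
    have : Projective (ShortComplex.mk _ _ (kernel.condition ε)).X₂ := hX 0
    refine (extVanishes_succ_iff_of_projective hS Y hi).2 ?_
    refine ih (kernel ε) (fun n => X (n + 1)) (fun n => d (n + 1)) (kernel.lift ε (d 0) dε)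
      (fun n => hX _) (fun n => dd _) (by rw [← cancel_mono (kernel.ι ε)]; simp [dd])
      h₀.epi_kernelLift ?_ (fun n => hs _) (fun n => hY _)
    -- Corestricting `d 0` to the kernel of ε does not affect exactness at `X 1`, since the
    -- inclusion is mono.
    let φ : ShortComplex.mk (d 1) (kernel.lift ε (d 0) dε)
        (by rw [← cancel_mono (kernel.ι ε)]; simp [dd]) ⟶ ShortComplex.mk (d 1) (d 0) (dd 0) :=
      { τ₁ := 𝟙 _, τ₂ := 𝟙 _, τ₃ := kernel.ι ε }
    have : Epi φ.τ₁ := inferInstanceAs (Epi (𝟙 _))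
    have : IsIso φ.τ₂ := inferInstanceAs (IsIso (𝟙 _))
    have : Mono φ.τ₃ := inferInstanceAs (Mono (kernel.ι ε))
    exact (ShortComplex.exact_iff_of_epi_of_isIso_of_mono φ).2 (hs 0)

end Ext

/-! ### Projective generators and injective cogenerators -/

section Generator

variable {C : Type u} [Category.{v} C] [Abelian C] {P : C}

lemma epi_of_isSeparator (hP : IsSeparator P) {X Y : C} (f : X ⟶ Y)
    (h : ∀ p : P ⟶ Y, ∃ q, q ≫ f = p) : Epi f := by
  refine Abelian.epi_of_cokernel_π_eq_zero f ?_
  refine (Preadditive.isSeparator_iff P).1 hP _ fun p => ?_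
  obtain ⟨q, rfl⟩ := h p
  simp

lemma mono_of_isSeparator (hP : IsSeparator P) {X Y : C} (f : X ⟶ Y)
    (h : ∀ p : P ⟶ X, p ≫ f = 0 → p = 0) : Mono f := by
  refine Preadditive.mono_of_cancel_zero f fun g hg => ?_
  refine (Preadditive.isSeparator_iff P).1 hP _ fun p => ?_
  exact h _ (by rw [Category.assoc, hg, comp_zero])

lemma isIso_of_isSeparator (hP : IsSeparator P) {X Y : C} (f : X ⟶ Y)
    (h : Function.Bijective fun p : P ⟶ X => p ≫ f) : IsIso f := by
  have := epi_of_isSeparator hP f h.surjective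
  have := mono_of_isSeparator hP f fun p hp => h.injective (by simpa using hp)
  exact isIso_of_mono_of_epi f

lemma exact_of_isSeparator (hP : IsSeparator P) (S : ShortComplex C)
    (h : ∀ p : P ⟶ S.X₂, p ≫ S.g = 0 → ∃ q, q ≫ S.f = p) : S.Exact := by
  rw [S.exact_iff_epi_kernel_lift]
  refine epi_of_isSeparator hP _ fun p => ?_
  obtain ⟨q, hq⟩ := h (p ≫ kernel.ι S.g) (by simp)
  exact ⟨q, by rw [← cancel_mono (kernel.ι S.g)]; simpa using hq⟩

lemma _root_.CategoryTheory.ShortComplex.Exact.exists_lift_of_projective {S : ShortComplex C}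
    (hS : S.Exact) [Projective P] (p : P ⟶ S.X₂) (hp : p ≫ S.g = 0) : ∃ q, q ≫ S.f = p := by
  have := hS.epi_kernelLift
  refine ⟨Projective.factorThru (kernel.lift _ p hp) (kernel.lift S.g S.f S.zero), ?_⟩
  have h := Projective.factorThru_comp (kernel.lift _ p hp) (kernel.lift S.g S.f S.zero) =≫
    kernel.ι S.g
  rwa [Category.assoc, kernel.lift_ι, kernel.lift_ι] at h

lemma _root_.CategoryTheory.ShortComplex.Exact.exists_desc_of_injective {S : ShortComplex C}
    (hS : S.Exact) {J : C} [Injective J] (p : S.X₂ ⟶ J) (hp : S.f ≫ p = 0) :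
    ∃ q, S.g ≫ q = p := by
  obtain ⟨q, hq⟩ := hS.op.exists_lift_of_projective (P := op J) p.op (Quiver.Hom.unop_inj hp)
  exact ⟨q.unop, Quiver.Hom.op_inj hq⟩

lemma epi_sigmaDesc_of_isSeparator [HasCoproducts.{v} C] (hP : IsSeparator P) (X : C) :
    Epi (Sigma.desc fun f : P ⟶ X => f) :=
  epi_of_isSeparator hP _ fun p => ⟨Sigma.ι (fun _ : P ⟶ X => P) p, by simp⟩

lemma mono_piLift_of_isCoseparator [HasProducts.{v} C] {J : C} (hJ : IsCoseparator J) (X : C) :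
    Mono (Pi.lift fun f : X ⟶ J => f) := by
  refine Preadditive.mono_of_cancel_zero _ fun g hg => ?_
  refine (Preadditive.isCoseparator_iff J).1 hJ _ fun p => ?_
  simpa using hg =≫ Pi.π (fun _ : X ⟶ J => J) p

lemma enoughProjectives_of_isSeparator [HasCoproducts.{v} C] [Projective P]
    (hP : IsSeparator P) : EnoughProjectives C where
  presentation X :=
    ⟨{ p := ∐ fun _ : P ⟶ X => P
       f := Sigma.desc fun f : P ⟶ X => f
       epi := epi_sigmaDesc_of_isSeparator hP X }⟩

lemma enoughInjectives_of_isCoseparator [HasProducts.{v} C] {J : C} [Injective J]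
    (hJ : IsCoseparator J) : EnoughInjectives C where
  presentation X :=
    ⟨{ J := ∏ᶜ fun _ : X ⟶ J => J
       f := Pi.lift fun f : X ⟶ J => f
       mono := mono_piLift_of_isCoseparator hJ X }⟩

/-- Over a projective separator `P`, every projective object is a summand of some `P^{(I)}`. -/
lemma addOf_of_projective [HasCoproducts.{v} C] (hP : IsSeparator P) (Q : C) [Projective Q] :
    AddOf P Q := by
  have := epi_sigmaDesc_of_isSeparator hP Q
  exact ⟨P ⟶ Q, ⟨⟨Projective.factorThru (𝟙 Q) (Sigma.desc fun f : P ⟶ Q => f),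
    Sigma.desc fun f : P ⟶ Q => f, Projective.factorThru_comp _ _⟩⟩⟩

end Generator

lemma projective_of_retract {C : Type u} [Category.{v} C] {X Y : C} (r : Retract X Y)
    [Projective Y] : Projective X where
  factors f e _ := ⟨r.i ≫ Projective.factorThru (r.r ≫ f) e, by simp⟩

/-! ### Algebras over a monad on sets, as sets with infinitary operations -/

namespace MonadAlgebra

variable {T : Monad (Type v)}

/-- The value at `t` of the operation on the algebra `M` defined by `t ∈ T X`. -/
def act (M : T.Algebra) {X : Type v} (x : X → M.A) (t : T.obj X) : M.A :=
  M.a (T.map (↾x) t)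

lemma act_η (M : T.Algebra) {X : Type v} (x : X → M.A) (i : X) :
    act M x (T.η.app X i) = x i := by
  have h := ConcreteCategory.congr_hom (T.η.naturality (↾x)) i
  have h' := ConcreteCategory.congr_hom M.unit (x i)
  simp only [types_comp_apply, Functor.id_map] at h h'
  unfold act
  rw [← h]
  exact h'

lemma act_map (M : T.Algebra) {X Y : Type v} (y : Y → M.A) (g : X → Y) (t : T.obj X) :
    act M y (T.map (↾g) t) = act M (fun i => y (g i)) t := by
  have h := ConcreteCategory.congr_hom (T.map_comp (↾g) (↾y)) t
  exact (congrArg M.a h).symm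

lemma act_μ (M : T.Algebra) {X : Type v} (x : X → M.A) (w : T.obj (T.obj X)) :
    act M x (T.μ.app X w) = act M (fun s => act M x s) w := by
  have h := ConcreteCategory.congr_hom (T.μ.naturality (↾x)) w
  have h' := ConcreteCategory.congr_hom M.assoc (T.map (T.map (↾x)) w)
  have h'' := ConcreteCategory.congr_hom (T.map_comp (T.map (↾x)) M.a) w
  exact ((congrArg M.a h).symm.trans h').trans (congrArg M.a h'').symm

lemma hom_act {M N : T.Algebra} (f : M ⟶ N) {X : Type v} (x : X → M.A) (t : T.obj X) :
    f.f (act M x t) = act N (fun i => f.f (x i)) t := by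
  have h := ConcreteCategory.congr_hom f.h (T.map (↾x) t)
  have h' := ConcreteCategory.congr_hom (T.map_comp (↾x) f.f) t
  exact h.symm.trans (congrArg N.a h').symm

/-- A function that commutes with the structure maps is a morphism of algebras. -/
def homMk {M N : T.Algebra} (f : M.A → N.A)
    (hf : ∀ t : T.obj M.A, f (act M id t) = act N f t) : M ⟶ N where
  f := ↾f
  h := by
    ext t
    have h := ConcreteCategory.congr_hom (T.map_id M.A) t
    exact (hf t).symm.trans (congrArg (fun s => f (M.a s)) h)

lemma hom_ext {M N : T.Algebra} {f g : M ⟶ N} (h : ∀ x, f.f x = g.f x) : f = g := by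
  ext x
  exact h x

lemma comp_f_apply {M N L : T.Algebra} (f : M ⟶ N) (g : N ⟶ L) (x : M.A) :
    (f ≫ g).f x = g.f (f.f x) := rfl

/-- The morphism out of a free algebra determined by the images of the generators. -/
def freeHom (M : T.Algebra) {X : Type v} (x : X → M.A) : T.free.obj X ⟶ M :=
  homMk (fun t : T.obj X => act M x t) fun t => by
    have h := ConcreteCategory.congr_hom (T.map_id (T.obj X)) t
    refine Eq.trans ?_ (act_μ M x t)
    exact congrArg (fun s => act M x (T.μ.app X s)) h

lemma freeHom_η (M : T.Algebra) {X : Type v} (x : X → M.A) (i : X) :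
    (freeHom M x).f (T.η.app X i) = x i := act_η M x i

lemma freeHom_comp {M N : T.Algebra} (f : M ⟶ N) {X : Type v} (x : X → M.A) :
    freeHom M x ≫ f = freeHom N fun i => f.f (x i) :=
  hom_ext fun t => hom_act f x t

lemma freeHom_injective (M : T.Algebra) {X : Type v} {x y : X → M.A}
    (h : freeHom M x = freeHom M y) (i : X) : x i = y i := by
  rw [← freeHom_η M x, h, freeHom_η]

/-- Any set-theoretic lift is compatible with the operations, because this can be checked after the
injective f. -/
lemma exists_lift {M N : T.Algebra} (f : M ⟶ N) {L : T.Algebra}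
    (hf : Function.Injective fun m => f.f m) (g : L ⟶ N)
    (h : ∀ l, ∃ m, f.f m = g.f l) : ∃ l : L ⟶ M, l ≫ f = g := by
  choose s hs using h
  refine ⟨homMk s fun t => hf ?_, hom_ext hs⟩
  simp only [hs, hom_act]
  rfl

lemma injective_of_mono {M N : T.Algebra} (f : M ⟶ N) [Mono f] :
    Function.Injective fun m => f.f m := by
  have : Mono (T.forget.map f) := inferInstance
  exact (mono_iff_injective (T.forget.map f)).1 this

lemma epi_of_surjective {M N : T.Algebra} (f : M ⟶ N) (hf : ∀ n, ∃ m, f.f m = n) : Epi f where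
  left_cancellation g h e := hom_ext fun q => by
    obtain ⟨n, rfl⟩ := hf q
    exact ConcreteCategory.congr_hom (congrArg Monad.Algebra.Hom.f e) n

/-- Substitution in free algebras. -/
def bind (T : Monad (Type v)) {X Y : Type v} (h : X → T.obj Y) (t : T.obj X) : T.obj Y :=
  T.μ.app Y (T.map (↾h) t)

lemma act_bind (M : T.Algebra) {X Y : Type v} (y : Y → M.A) (h : X → T.obj Y) (t : T.obj X) :
    act M y (bind T h t) = act M (fun i => act M y (h i)) t := by
  rw [bind, act_μ, act_map]

lemma bind_η {X Y : Type v} (h : X → T.obj Y) (i : X) : bind T h (T.η.app X i) = h i :=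
  act_η (T.free.obj Y) h i

lemma bind_id {X : Type v} (w : T.obj (T.obj X)) : bind T id w = T.μ.app X w :=
  congrArg (T.μ.app X) (ConcreteCategory.congr_hom (T.map_id (T.obj X)) w)

lemma map_eq_bind {X Y : Type v} (g : X → Y) (t : T.obj X) :
    T.map (↾g) t = bind T (fun i => T.η.app Y (g i)) t := by
  have h' := ConcreteCategory.congr_hom (T.map_comp (↾g) (T.η.app Y)) t
  have h'' := ConcreteCategory.congr_hom (T.right_unit Y) (T.map (↾g) t)
  exact h''.symm.trans (congrArg (T.μ.app Y) h').symm

end MonadAlgebra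

open MonadAlgebra

/-- A monad on the category of sets is additive if its values are abelian groups, in such a way
that substitution in free algebras is biadditive. -/
class AdditiveMonad (T : Monad (Type v)) where
  group (X : Type v) : AddCommGroup (T.obj X)
  bind_add {X Y : Type v} (h : X → T.obj Y) (s t : T.obj X) :
    bind T h (s + t) = bind T h s + bind T h t
  bind_add_left {X Y : Type v} (h h' : X → T.obj Y) (t : T.obj X) :
    bind T (fun i => h i + h' i) t = bind T h t + bind T h' t

attribute [reducible, instance] AdditiveMonad.group

/-! ### Algebras over an additive monad form an abelian category -/

namespace MonadAlgebra

section Group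

variable {T : Monad (Type v)} [AdditiveMonad T]

lemma map_add {X Y : Type v} (g : X → Y) (s t : T.obj X) :
    T.map (↾g) (s + t) = T.map (↾g) s + T.map (↾g) t := by
  rw [map_eq_bind, map_eq_bind, map_eq_bind, AdditiveMonad.bind_add]

instance (M : T.Algebra) : Add M.A := ⟨fun x y => act M id (T.η.app _ x + T.η.app _ y)⟩

lemma add_def (M : T.Algebra) (x y : M.A) : x + y = act M id (T.η.app _ x + T.η.app _ y) := rfl

/-- The element s + t is the multiplication μ applied to η s + η t, so associativity of the action
reduces the claim to the definition of the sum in M. -/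
lemma act_add (M : T.Algebra) {X : Type v} (x : X → M.A) (s t : T.obj X) :
    act M x (s + t) = act M x s + act M x t := by
  have h : bind T id (T.η.app _ s + T.η.app _ t) = s + t := by
    rw [AdditiveMonad.bind_add, bind_η, bind_η, id, id]
  have hη (r : T.obj X) : T.map (↾fun s => act M x s) (T.η.app _ r) = T.η.app _ (act M x r) :=
    (ConcreteCategory.congr_hom (T.η.naturality (↾fun s => act M x s)) r).symm
  rw [← h, bind_id, act_μ, add_def, ← hη, ← hη, ← map_add, act_map]
  rfl

instance (M : T.Algebra) : Zero M.A := ⟨act M id 0⟩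

instance (M : T.Algebra) : Neg M.A := ⟨fun x => act M id (-T.η.app _ x)⟩

instance (M : T.Algebra) : AddCommGroup M.A :=
  { AddGroup.ofLeftAxioms (G := M.A)
      (fun x y z => by
        -- Evaluation `act M id` is additive and surjective, so the axioms descend from the group
        -- `T.obj M.A`.
        obtain ⟨x, rfl⟩ : ∃ x', act M id x' = x := ⟨_, act_η M id x⟩
        obtain ⟨y, rfl⟩ : ∃ x', act M id x' = y := ⟨_, act_η M id y⟩
        obtain ⟨z, rfl⟩ : ∃ x', act M id x' = z := ⟨_, act_η M id z⟩
        rw [← act_add, ← act_add, ← act_add, ← act_add, add_assoc])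
      (fun x => by
        obtain ⟨x, rfl⟩ : ∃ x', act M id x' = x := ⟨_, act_η M id x⟩
        exact (act_add M id 0 x).symm.trans (by rw [zero_add]))
      (fun x => by
        have h := act_add M id (-T.η.app _ x) (T.η.app _ x)
        rw [act_η, neg_add_cancel] at h
        exact h.symm) with
    add_comm := fun x y => by
      rw [add_def, add_def, add_comm] }

lemma hom_add {M N : T.Algebra} (f : M ⟶ N) (x y : M.A) : f.f (x + y) = f.f x + f.f y := by
  rw [add_def, hom_act, act_add, act_η, act_η]
  rfl

/-- The identity holds for generators of the free algebra on M, and evaluation in M preserves it. It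
is what makes pointwise sums of morphisms into morphisms. -/
lemma act_add_left (M : T.Algebra) {X : Type v} (x y : X → M.A) (t : T.obj X) :
    act M (fun i => x i + y i) t = act M x t + act M y t := by
  have h := congrArg (act M id) (AdditiveMonad.bind_add_left (T := T) (Y := M.A)
    (fun i => T.η.app _ (x i)) (fun i => T.η.app _ (y i)) t)
  rw [act_bind, act_add, act_bind, act_bind] at h
  simpa only [act_η, act_add, id] using h

/-- A morphism of algebras, as a homomorphism of groups. -/
def homAddHom {M N : T.Algebra} (f : M ⟶ N) : M.A →+ N.A :=
  AddMonoidHom.mk' (fun x => f.f x) (hom_add f)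

lemma homAddHom_apply {M N : T.Algebra} (f : M ⟶ N) (x : M.A) : homAddHom f x = f.f x := rfl

/-- The operation defined by `t ∈ T X`, as a homomorphism of groups. -/
def actAddHom (M : T.Algebra) {X : Type v} (t : T.obj X) : (X → M.A) →+ M.A :=
  AddMonoidHom.mk' (fun x => act M x t) fun x y => act_add_left M x y t

instance (M N : T.Algebra) : Add (M ⟶ N) :=
  ⟨fun f g => homMk (fun x => f.f x + g.f x) fun t => by
    rw [act_add_left, hom_act, hom_act]; rfl⟩

instance (M N : T.Algebra) : Zero (M ⟶ N) :=
  ⟨homMk (fun _ => 0) fun t => ((actAddHom N t).map_zero).symm⟩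

lemma freeHom_zero (M : T.Algebra) {X : Type v} :
    freeHom M (fun _ : X => (0 : M.A)) = 0 :=
  hom_ext fun t => (actAddHom M t).map_zero

instance (M N : T.Algebra) : Neg (M ⟶ N) :=
  ⟨fun f => homMk (fun x => -f.f x) fun t => by
    rw [hom_act]
    exact ((actAddHom N t).map_neg (fun x => (f.f x : N.A))).symm⟩

lemma zero_f_apply {M N : T.Algebra} (x : M.A) : (0 : M ⟶ N).f x = 0 := rfl

instance (M N : T.Algebra) : AddCommGroup (M ⟶ N) :=
  { AddGroup.ofLeftAxioms (G := M ⟶ N)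
      (fun _ _ _ => hom_ext fun _ => add_assoc _ _ _)
      (fun _ => hom_ext fun _ => zero_add _)
      (fun _ => hom_ext fun _ => neg_add_cancel _) with
    add_comm := fun _ _ => hom_ext fun _ => add_comm _ _ }

instance : Preadditive T.Algebra where
  add_comp _ _ _ _ _ g := hom_ext fun _ => hom_add g _ _
  comp_add _ _ _ _ _ _ := hom_ext fun _ => rfl

end Group

section Abelian

variable {T : Monad (Type v)} [AdditiveMonad T] {M N : T.Algebra} (f : M ⟶ N)

/-- Operations descend to the cokernel: changing every argument by some f(kᵢ) changes the value by f
of the same operation applied to the whole family k, even when X is infinite. -/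
lemma mk_act_out {X : Type v} (x : X → N.A) (t : T.obj X) :
    (QuotientAddGroup.mk (act N (fun i => (QuotientAddGroup.mk (x i) :
      N.A ⧸ (homAddHom f).range).out) t) : N.A ⧸ (homAddHom f).range) =
      QuotientAddGroup.mk (act N x t) := by
  have h (i : X) : ∃ k, f.f k = x i - (QuotientAddGroup.mk (x i) :
      N.A ⧸ (homAddHom f).range).out := by
    have h' : (QuotientAddGroup.mk (QuotientAddGroup.mk (x i) :
      N.A ⧸ (homAddHom f).range).out : N.A ⧸ (homAddHom f).range) = QuotientAddGroup.mk (x i) :=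
      QuotientAddGroup.out_eq' _
    rw [QuotientAddGroup.eq] at h'
    obtain ⟨k, hk⟩ := h'
    exact ⟨k, hk.trans (by abel)⟩
  choose k hk using h
  rw [QuotientAddGroup.eq]
  refine ⟨act M k t, ?_⟩
  rw [homAddHom_apply, hom_act]
  simp only [hk]
  rw [neg_add_eq_sub]
  exact (actAddHom N t).map_sub _ _

/-- The cokernel of a morphism of algebras over an additive monad. -/
def coker : T.Algebra where
  A := N.A ⧸ (homAddHom f).range
  a := ↾fun t => QuotientAddGroup.mk
    (act N (fun q : N.A ⧸ (homAddHom f).range => (q.out : N.A)) t)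
  unit := by
    ext q
    have h := act_η N (fun q : N.A ⧸ (homAddHom f).range => (q.out : N.A)) q
    exact (congrArg _ h).trans (QuotientAddGroup.out_eq' q)
  assoc := by
    ext w
    have h := act_μ N (fun q : N.A ⧸ (homAddHom f).range => (q.out : N.A)) w
    have h' := act_map N (fun q : N.A ⧸ (homAddHom f).range => (q.out : N.A))
      (fun t => QuotientAddGroup.mk
        (act N (fun q : N.A ⧸ (homAddHom f).range => (q.out : N.A)) t)) w
    refine (congrArg QuotientAddGroup.mk h).trans ?_
    exact (mk_act_out f _ w).symm.trans (congrArg QuotientAddGroup.mk h').symm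

lemma act_coker {X : Type v} (x : X → N.A) (t : T.obj X) :
    act (coker f) (fun i => (QuotientAddGroup.mk (x i) : N.A ⧸ (homAddHom f).range)) t =
      (QuotientAddGroup.mk (act N x t) : N.A ⧸ (homAddHom f).range) := by
  refine Eq.trans ?_ (mk_act_out f x t)
  exact congrArg QuotientAddGroup.mk (act_map N (fun q : N.A ⧸ (homAddHom f).range => (q.out : N.A))
    (fun i => QuotientAddGroup.mk (x i)) t)

/-- The projection onto the cokernel. -/
def cokerπ : N ⟶ coker f :=
  homMk (fun n => (QuotientAddGroup.mk n : N.A ⧸ (homAddHom f).range)) fun t =>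
    (act_coker f id t).symm

lemma cokerπ_surjective (q : (coker f).A) : ∃ n, (cokerπ f).f n = q :=
  QuotientAddGroup.mk_surjective q

lemma cokerπ_eq_iff (n n' : N.A) :
    (cokerπ f).f n = (cokerπ f).f n' ↔ ∃ m, f.f m = -n + n' :=
  QuotientAddGroup.eq (s := (homAddHom f).range)

lemma cokerπ_eq_zero_iff (n : N.A) : (cokerπ f).f n = 0 ↔ ∃ m, f.f m = n := by
  have h : (cokerπ f).f 0 = 0 := (homAddHom (cokerπ f)).map_zero
  rw [← h, eq_comm, cokerπ_eq_iff, neg_zero, zero_add]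

lemma comp_cokerπ : f ≫ cokerπ f = 0 :=
  hom_ext fun x => (cokerπ_eq_zero_iff f _).2 ⟨x, rfl⟩

/-- A morphism along a surjection of algebras that kills its kernel factors through it. -/
lemma exists_desc {L : T.Algebra} (hf : ∀ n, ∃ m, f.f m = n) (g : M ⟶ L)
    (h : ∀ m, f.f m = 0 → g.f m = 0) : ∃ l : N ⟶ L, f ≫ l = g := by
  choose s hs using hf
  have key (m : M.A) : g.f (s (f.f m)) = g.f m := by
    rw [← sub_eq_zero]
    refine ((homAddHom g).map_sub _ _).symm.trans (h _ ?_)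
    refine ((homAddHom f).map_sub _ _).trans ?_
    rw [homAddHom_apply, homAddHom_apply, hs, sub_self]
  refine ⟨homMk (fun n => g.f (s n)) fun t => ?_, hom_ext key⟩
  have ht : act N id t = f.f (act M s t) := by
    rw [hom_act]; simp only [hs]; rfl
  rw [ht, key, hom_act]

instance : Epi (cokerπ f) where
  left_cancellation g h e := hom_ext fun q => by
    obtain ⟨n, rfl⟩ := cokerπ_surjective f q
    exact ConcreteCategory.congr_hom (congrArg Monad.Algebra.Hom.f e) n

/-- Since f is epi and is killed by its cokernel projection, that projection is zero, so all of N
lies in the image. -/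
lemma surjective_of_epi [Epi f] (n : N.A) : ∃ m, f.f m = n := by
  have h : cokerπ f = 0 := by rw [← cancel_epi f, comp_cokerπ, comp_zero]
  rw [← cokerπ_eq_zero_iff, h, zero_f_apply]

instance : HasCokernels T.Algebra where
  has_colimit f := ⟨⟨⟨CokernelCofork.ofπ (cokerπ f) (comp_cokerπ f),
    Cofork.IsColimit.mk' _ fun s => by
      have hs := exists_desc (cokerπ f) (cokerπ_surjective f) s.π fun n hn => by
        obtain ⟨m, rfl⟩ := (cokerπ_eq_zero_iff f n).1 hn
        have := CokernelCofork.condition s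
        rw [← comp_f_apply, this, zero_f_apply]
      exact ⟨hs.choose, hs.choose_spec, fun {l} hl =>
        (cancel_epi (cokerπ f)).1 (hl.trans hs.choose_spec.symm)⟩⟩⟩⟩

instance : HasLimits T.Algebra :=
  hasLimits_of_hasLimits_createsLimits T.forget

instance : Abelian T.Algebra where
  normalMonoOfMono {M N} f _ := ⟨
    { Z := coker f
      g := cokerπ f
      w := comp_cokerπ f
      isLimit := Fork.IsLimit.mk' _ fun s => by
        have hs := exists_lift f (injective_of_mono f) s.ι fun l => by
          rw [← cokerπ_eq_zero_iff, ← comp_f_apply, KernelFork.condition s, zero_f_apply]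
        exact ⟨hs.choose, hs.choose_spec, fun {l} hl =>
          (cancel_mono f).1 (hl.trans hs.choose_spec.symm)⟩ }⟩
  normalEpiOfEpi {M N} f _ := ⟨
    -- The free algebra on the kernel's elements can stand in for the kernel: a morphism kills its
    -- image exactly when it kills the generators.
    { W := T.free.obj {m : M.A // f.f m = 0}
      g := freeHom M Subtype.val
      w := by
        rw [freeHom_comp]
        exact (congrArg (freeHom N) (funext Subtype.prop)).trans (freeHom_zero N)
      isColimit := Cofork.IsColimit.mk' _ fun s => by
        have hs := exists_desc f (surjective_of_epi f) s.π fun m hm => by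
          refine freeHom_injective s.pt (x := fun m : {m : M.A // f.f m = 0} => s.π.f m.1)
            (y := fun _ => 0) ?_ ⟨m, hm⟩
          rw [← freeHom_comp s.π, CokernelCofork.condition s, freeHom_zero]
        exact ⟨hs.choose, hs.choose_spec, fun {l} hl =>
          (cancel_epi f).1 (hl.trans hs.choose_spec.symm)⟩ }⟩
  has_finite_products := inferInstance
  has_kernels := inferInstance
  has_cokernels := inferInstance

end Abelian

section Colimits

variable {T : Monad (Type v)} [AdditiveMonad T]

/-- Adjoint triangle theorem: the diagonal functor followed by the forgetful functor is a right
adjoint, and the counit of the free-forgetful adjunction on diagrams is pointwise surjective, hence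
a regular epimorphism. So the diagonal functor has a left adjoint. -/
instance (J : Type v) [SmallCategory J] : HasColimitsOfShape J T.Algebra := by
  have h (K : J ⥤ T.Algebra) : Nonempty (RegularEpi ((T.adj.whiskerRight J).counit.app K)) := by
    have (j : J) : Epi (((T.adj.whiskerRight J).counit.app K).app j) := by
      have h : ((T.adj.whiskerRight J).counit.app K).app j = T.adj.counit.app (K.obj j) := by
        ext1
        simp
        rfl
      rw [h]
      refine epi_of_surjective _ fun x => ⟨T.η.app _ x, ?_⟩
      rw [Monad.adj_counit]
      exact ConcreteCategory.congr_hom (K.obj j).unit x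
    have := NatTrans.epi_of_epi_app ((T.adj.whiskerRight J).counit.app K)
    exact ⟨regularEpiOfEpi _⟩
  have : (Functor.const J ⋙ (Functor.whiskeringRight J _ _).obj T.forget :
      T.Algebra ⥤ J ⥤ Type v).IsRightAdjoint := by
    have : (Functor.const J : Type v ⥤ _).IsRightAdjoint := ⟨_, ⟨colimConstAdj⟩⟩
    have : (T.forget ⋙ (Functor.const J : Type v ⥤ _)).IsRightAdjoint := inferInstance
    exact Functor.isRightAdjoint_of_iso
      (NatIso.ofComponents (fun M => NatIso.ofComponents fun j => Iso.refl _) :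
        T.forget ⋙ (Functor.const J : Type v ⥤ _) ≅ _)
  rw [hasColimitsOfShape_iff_isRightAdjoint_const]
  exact isRightAdjoint_triangle_lift _ (T.adj.whiskerRight J) fun K => (h K).some

instance : HasColimits T.Algebra where
  has_colimits_of_shape _ := inferInstance

end Colimits

end MonadAlgebra

/-! ### Additivity of the monad X ↦ Hom(T, T^(X)) -/

section Sigma

variable {C : Type u} [Category.{v} C] [HasCoproducts.{v} C] (T : C)

/-- The extension of a family of elements of the monad to a morphism of coproducts. -/
def sigmaConstDesc {X Y : Type v} (h : X → (sigmaConstAdj.{v} T).toMonad.obj Y) :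
    (∐ fun _ : X => T) ⟶ ∐ fun _ : Y => T :=
  Sigma.desc fun i => (show T ⟶ ∐ fun _ : Y => T from h i)

lemma ι_sigmaConstDesc {X Y : Type v} (h : X → (sigmaConstAdj.{v} T).toMonad.obj Y) (i : X) :
    Sigma.ι (fun _ : X => T) i ≫ sigmaConstDesc T h = h i :=
  Sigma.ι_desc _ _

/-- Substitution is composition in C, so its biadditivity is that of composition. -/
lemma bind_sigmaConstAdj {X Y : Type v} (h : X → (sigmaConstAdj.{v} T).toMonad.obj Y)
    (t : (sigmaConstAdj.{v} T).toMonad.obj X) :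
    bind _ h t = (show T ⟶ ∐ fun _ : X => T from t) ≫ sigmaConstDesc T h := by
  have key : (sigmaConst.obj T).map (↾h) ≫ (sigmaConstAdj T).counit.app (∐ fun _ : Y => T) =
      sigmaConstDesc T h := by
    refine Sigma.hom_ext _ _ fun i => ?_
    rw [ι_sigmaConstDesc]
    refine (Sigma.ι_comp_map'_assoc _ _ _ _).trans ?_
    rw [Category.id_comp]
    exact Sigma.ι_desc _ _
  rw [← key]
  exact Category.assoc _ _ _

instance [Preadditive C] : AdditiveMonad (sigmaConstAdj.{v} T).toMonad where
  group X := inferInstanceAs (AddCommGroup (T ⟶ ∐ fun _ : X => T))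
  bind_add h s t := by
    rw [bind_sigmaConstAdj, bind_sigmaConstAdj, bind_sigmaConstAdj]
    exact Preadditive.add_comp _ _ _ _ _ _
  bind_add_left {X Y} h h' t := by
    rw [bind_sigmaConstAdj, bind_sigmaConstAdj, bind_sigmaConstAdj]
    refine Eq.trans ?_ (Preadditive.comp_add _ _ _ _ _ _)
    refine congrArg (fun f : (∐ fun _ : X => T) ⟶ ∐ fun _ : Y => T =>
      (show T ⟶ ∐ fun _ : X => T from t) ≫ f) ?_
    refine Sigma.hom_ext _ _ fun i => ?_
    rw [Preadditive.comp_add]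
    rw [ι_sigmaConstDesc, ι_sigmaConstDesc, ι_sigmaConstDesc]
    rfl

end Sigma

lemma isIso_app_of_retract {C D : Type*} [Category* C] [Category* D] {F G : C ⥤ D} (α : F ⟶ G)
    {X Y : C} (r : Retract X Y) [IsIso (α.app Y)] : IsIso (α.app X) :=
  ⟨G.map r.i ≫ inv (α.app Y) ≫ F.map r.r, by
    rw [← NatTrans.naturality_assoc, IsIso.hom_inv_id_assoc, ← F.map_comp, r.retract, F.map_id], by
    rw [Category.assoc, Category.assoc, α.naturality, IsIso.inv_hom_id_assoc, ← G.map_comp,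
      r.retract, G.map_id]⟩

/-! ### Canonical coresolutions by powers of an injective cogenerator -/

section Coresolution

variable {A : Type u} [Category.{v} A] [Abelian A] [HasProducts.{v} A] (J : A)

/-- The canonical morphism from `M` to a product of copies of `J`. -/
def toProd (M : A) : M ⟶ ∏ᶜ fun _ : M ⟶ J => J := Pi.lift fun f => f

/-- The iterated cokernels of the canonical morphisms to products of copies of `J`. -/
def cosyzygy (M : A) : ℕ → A
  | 0 => M
  | n + 1 => cokernel (toProd J (cosyzygy M n))

/-- The terms of the canonical coresolution by products of copies of `J`. -/
def cores (M : A) (n : ℕ) : A := ∏ᶜ fun _ : cosyzygy J M n ⟶ J => J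

/-- The embedding of a cosyzygy. -/
def coresι (M : A) (n : ℕ) : cosyzygy J M n ⟶ cores J M n := toProd J _

/-- The projection to the next cosyzygy. -/
def coresπ (M : A) (n : ℕ) : cores J M n ⟶ cosyzygy J M (n + 1) := cokernel.π _

/-- The differential of the canonical coresolution. -/
def coresD (M : A) (n : ℕ) : cores J M n ⟶ cores J M (n + 1) :=
  coresπ J M n ≫ coresι J M (n + 1)

variable (M : A)

lemma coresι_π (n : ℕ) : coresι J M n ≫ coresπ J M n = 0 := cokernel.condition _

lemma coresι_D (n : ℕ) : coresι J M n ≫ coresD J M n = 0 := by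
  rw [coresD, ← Category.assoc, coresι_π, zero_comp]

instance (n : ℕ) : Epi (coresπ J M n) := 
  (inferInstance : Epi (cokernel.π (toProd J (cosyzygy J M n))))

instance [Injective J] (n : ℕ) : Injective (cores J M n) :=
  inferInstanceAs (Injective (∏ᶜ _))

variable {J} (hJ : IsCoseparator J)

include hJ

lemma mono_coresι (n : ℕ) : Mono (coresι J M n) := mono_piLift_of_isCoseparator hJ _

lemma shortExact_cores (n : ℕ) :
    (ShortComplex.mk (coresι J M n) (coresπ J M n) (coresι_π J M n)).ShortExact :=
  have := mono_coresι M hJ n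
  shortExact_cokernel_π (coresι J M n)

/-- A morphism killed by the differential comes from the cosyzygy. -/
lemma exists_lift_coresι {X : A} {n : ℕ} (f : X ⟶ cores J M n) (hf : f ≫ coresD J M n = 0) :
    ∃ g, g ≫ coresι J M n = f := by
  have := mono_coresι M hJ (n + 1)
  have := mono_coresι M hJ n
  have hf' : f ≫ coresπ J M n = 0 := by
    rw [← cancel_mono (coresι J M (n + 1)), Category.assoc, zero_comp]
    exact hf
  exact ⟨(shortExact_cores M hJ n).exact.lift f hf', (shortExact_cores M hJ n).exact.lift_f _ _⟩

/-- The map f descends to the next cosyzygy and then extends along its embedding, J being injective.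
Thus the coresolution stays exact under Hom(-, J). -/
lemma exists_desc_coresD [Injective J] {n : ℕ} (f : cores J M n ⟶ J)
    (hf : coresι J M n ≫ f = 0) : ∃ g, coresD J M n ≫ g = f := by
  have := mono_coresι M hJ (n + 1)
  obtain ⟨g, hg⟩ := (shortExact_cores M hJ n).exact.exists_desc_of_injective f hf
  refine ⟨Injective.factorThru g (coresι J M (n + 1)), ?_⟩
  rw [coresD, Category.assoc, Injective.comp_factorThru]
  exact hg

lemma extVanishes_cosyzygy [Injective J] {T : A} (hT : ∀ i, 0 < i → ExtVanishes T M i) :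
    ∀ n i, 0 < i → ExtVanishes T (cosyzygy J M n) i
  | 0 => hT
  | n + 1 => fun i hi => by
    have : Injective (ShortComplex.mk _ _ (coresι_π J M n)).X₂ :=
      inferInstanceAs (Injective (cores J M n))
    exact (extVanishes_succ_iff_of_injective (shortExact_cores M hJ n) T hi).1
      (extVanishes_cosyzygy hT n _ (Nat.succ_pos i))

/-- If `Ext^i(T, M) = 0` for `i > 0`, the coresolution of `M` stays exact under `Hom(T, -)`. -/
lemma exists_lift_coresD [Injective J] {T : A} (hT : ∀ i, 0 < i → ExtVanishes T M i) {n : ℕ}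
    (f : T ⟶ cores J M (n + 1)) (hf : f ≫ coresD J M (n + 1) = 0) :
    ∃ g, g ≫ coresD J M n = f := by
  obtain ⟨g, rfl⟩ := exists_lift_coresι M hJ f hf
  have : Injective (ShortComplex.mk _ _ (coresι_π J M n)).X₂ :=
    inferInstanceAs (Injective (cores J M n))
  obtain ⟨k, rfl⟩ := (extVanishes_one_iff_of_injective (shortExact_cores M hJ n) T).1
    (extVanishes_cosyzygy M hJ hT n 1 one_pos) g
  exact ⟨k, (Category.assoc _ _ _).symm⟩

end Coresolution

section Adjunction

variable {A B : Type*} [Category* A] [Category* B] {Φ : B ⥤ A} {Ψ : A ⥤ B}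

/-- `Ψ` is full on morphisms out of objects with invertible counit. -/
lemma exists_map_eq (adj : Φ ⊣ Ψ) {Y Z : A} [IsIso (adj.counit.app Y)]
    (f : Ψ.obj Y ⟶ Ψ.obj Z) : ∃ g : Y ⟶ Z, Ψ.map g = f := by
  refine ⟨inv (adj.counit.app Y) ≫ Φ.map f ≫ adj.counit.app Z, ?_⟩
  apply (adj.homEquiv _ _).symm.injective
  rw [adj.homEquiv_counit, adj.homEquiv_counit, adj.counit_naturality, IsIso.hom_inv_id_assoc]

lemma eq_of_map_eq (adj : Φ ⊣ Ψ) {Y Z : A} [Epi (adj.counit.app Y)] {f g : Y ⟶ Z}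
    (h : Ψ.map f = Ψ.map g) : f = g := by
  exact (cancel_epi (adj.counit.app Y)).1 ((adj.counit_naturality f).symm.trans
    ((congrArg (fun k => Φ.map k ≫ adj.counit.app Z) h).trans (adj.counit_naturality g)))

lemma isIso_counit_obj (adj : Φ ⊣ Ψ) (Q : B) [IsIso (adj.unit.app Q)] :
    IsIso (adj.counit.app (Φ.obj Q)) := by
  have h := adj.left_triangle_components Q
  exact IsIso.of_isIso_fac_left h

end Adjunction

/-! ### Tilting adjunctions and transport of resolutions along them -/

section Core

variable {A : Type*} [Category.{v} A] [Abelian A] {B : Type*} [Category.{v} B] [Abelian B]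

/-- The adjunction `Φ ⊣ Ψ` identifies the projective objects of `B`, among them the projective
separator `P`, with objects of `A`, among them `T`. -/
structure IsTiltingAdjunction {Φ : B ⥤ A} {Ψ : A ⥤ B} (adj : Φ ⊣ Ψ) (T : A) (P : B) : Prop where
  projective : Projective P
  separator : IsSeparator P
  isIso_unit (Q : B) : Projective Q → IsIso (adj.unit.app Q)
  iso : Nonempty (T ≅ Φ.obj P)

variable {Φ : B ⥤ A} {Ψ : A ⥤ B} {adj : Φ ⊣ Ψ} {T : A} {P : B}

namespace IsTiltingAdjunction

variable (h : IsTiltingAdjunction adj T P)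

include h

/-- Maps P → Ψ(Y) are maps T → Y by adjunction. The transpose of p is killed by every g whose image
Ψ(g) kills p, so `hf` may assume these relations; this serves both exactness and surjectivity. -/
lemma exists_lift {X Y : A} {f : X ⟶ Y} (p : P ⟶ Ψ.obj Y)
    (hf : ∀ t : T ⟶ Y, (∀ Z (g : Y ⟶ Z), p ≫ Ψ.map g = 0 → t ≫ g = 0) → ∃ s, s ≫ f = t) :
    ∃ q, q ≫ Ψ.map f = p := by
  obtain ⟨i⟩ := h.iso
  have : Φ.IsLeftAdjoint := ⟨_, ⟨adj⟩⟩
  obtain ⟨s, hs⟩ := hf (i.hom ≫ (adj.homEquiv _ _).symm p) fun Z g hg => by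
    rw [Category.assoc, ← adj.homEquiv_naturality_right_symm, hg, adj.homEquiv_counit,
      Functor.map_zero, zero_comp, comp_zero]
  refine ⟨adj.homEquiv _ _ (i.inv ≫ s), ?_⟩
  rw [← adj.homEquiv_naturality_right, Category.assoc, hs, i.inv_hom_id_assoc,
    Equiv.apply_symm_apply]

lemma exact_map {X Y Z : A} (f : X ⟶ Y) (g : Y ⟶ Z) (w : Ψ.map f ≫ Ψ.map g = 0)
    (hf : ∀ t : T ⟶ Y, t ≫ g = 0 → ∃ s, s ≫ f = t) :
    (ShortComplex.mk (Ψ.map f) (Ψ.map g) w).Exact :=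
  exact_of_isSeparator h.separator _ fun p hp =>
    h.exists_lift p fun t ht => hf t (ht _ g hp)

lemma epi_map {X Y : A} (f : X ⟶ Y) (hf : ∀ t : T ⟶ Y, ∃ s, s ≫ f = t) : Epi (Ψ.map f) :=
  epi_of_isSeparator h.separator _ fun p => h.exists_lift p fun t _ => hf t

variable [HasCoproducts.{v} A] [HasCoproducts.{v} B]

omit [Abelian A] [Abelian B] in
-- A left adjoint preserves coproducts, so T^(I) ≅ Φ(P^(I)) with P^(I) projective.
lemma retract_of_addOf {M : A} (hM : AddOf T M) :
    ∃ Q : B, Projective Q ∧ Nonempty (Retract M (Φ.obj Q)) := by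
  obtain ⟨I, ⟨r⟩⟩ := hM
  obtain ⟨i⟩ := h.iso
  have := h.projective
  have : PreservesColimitsOfSize.{v, v} Φ := adj.leftAdjoint_preservesColimits
  exact ⟨∐ fun _ : I => P, inferInstance,
    ⟨r.trans (Retract.ofIso (Sigma.mapIso (fun _ => i) ≪≫ (PreservesCoproduct.iso Φ _).symm))⟩⟩

omit [Abelian A] [Abelian B] in
lemma isIso_counit_of_addOf {M : A} (hM : AddOf T M) : IsIso (adj.counit.app M) := by
  obtain ⟨Q, hQ, ⟨r⟩⟩ := h.retract_of_addOf hM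
  have := h.isIso_unit Q hQ
  have := isIso_counit_obj adj Q
  exact isIso_app_of_retract adj.counit r

omit [Abelian A] [Abelian B] in
lemma projective_of_addOf {M : A} (hM : AddOf T M) : Projective (Ψ.obj M) := by
  obtain ⟨Q, hQ, ⟨r⟩⟩ := h.retract_of_addOf hM
  have := h.isIso_unit Q hQ
  exact projective_of_retract ((r.map Ψ).trans (Retract.ofIso (asIso (adj.unit.app Q)).symm))

omit [Abelian A] in
lemma addOf_obj {Q : B} (hQ : Projective Q) : AddOf T (Φ.obj Q) := by
  obtain ⟨I, ⟨r⟩⟩ := addOf_of_projective h.separator Q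
  obtain ⟨i⟩ := h.iso
  have : PreservesColimitsOfSize.{v, v} Φ := adj.leftAdjoint_preservesColimits
  exact ⟨I, ⟨(r.map Φ).trans (Retract.ofIso
    (PreservesCoproduct.iso Φ _ ≪≫ Sigma.mapIso (fun _ => i.symm)))⟩⟩

/-- The counit is invertible at `X 0` and `X 1`. Its inverse at `X 0`, followed by ΦΨ(ε), kills `d
0` and so descends to E; this is inverse to the counit at E because both ε and ΦΨ(ε) are epi. -/
lemma isIso_counit_of_addResolution {E : A} (R : AddResolution T E) :
    IsIso (adj.counit.app E) := by
  have : Φ.IsLeftAdjoint := ⟨_, ⟨adj⟩⟩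
  have : Ψ.IsRightAdjoint := ⟨_, ⟨adj⟩⟩
  have := h.epi_map R.ε R.hom_surjective
  have := h.isIso_counit_of_addOf (R.mem_add 0)
  have := h.isIso_counit_of_addOf (R.mem_add 1)
  have := R.epi_ε
  have hw : R.d 0 ≫ inv (adj.counit.app (R.X 0)) ≫ Φ.map (Ψ.map R.ε) = 0 := by
    refine (cancel_epi (adj.counit.app (R.X 1))).1
      ((adj.counit_naturality_assoc (R.d 0) _).symm.trans ?_)
    rw [IsIso.hom_inv_id_assoc, ← Φ.map_comp, ← Ψ.map_comp, R.d_comp_ε, Functor.map_zero,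
      Functor.map_zero, comp_zero]
  have : Epi (ShortComplex.mk (R.d 0) R.ε R.d_comp_ε).g := R.epi_ε
  let u := R.exact_zero.desc _ hw
  have hu : R.ε ≫ u = inv (adj.counit.app (R.X 0)) ≫ Φ.map (Ψ.map R.ε) :=
    R.exact_zero.g_desc _ hw
  refine ⟨u, ?_, ?_⟩
  · rw [← cancel_epi (Φ.map (Ψ.map R.ε)), adj.counit_naturality_assoc, hu,
      IsIso.hom_inv_id_assoc]
    exact (Category.comp_id _).symm
  · refine (cancel_epi R.ε).1 (((reassoc_of% hu) (adj.counit.app E)).trans ?_)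
    exact (congrArg (fun k => inv (adj.counit.app (R.X 0)) ≫ k) (adj.counit_naturality R.ε)).trans
      ((IsIso.inv_hom_id_assoc _ _).trans (Category.comp_id _).symm)

/-- Ψ turns R into a projective resolution of Ψ(E). Maps from its terms to Ψ(J) are maps from the
terms of R to J, as the counit is invertible on Add(T), and Hom(-, J) is exact. -/
lemma extVanishes_map {E J : A} (R : AddResolution T E) [Injective J] {i : ℕ} (hi : 0 < i) :
    ExtVanishes (Ψ.obj E) (Ψ.obj J) i := by
  have : Ψ.IsRightAdjoint := ⟨_, ⟨adj⟩⟩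
  refine extVanishes_of_resolution _ hi _ (fun n => Ψ.obj (R.X n)) (fun n => Ψ.map (R.d n))
    (Ψ.map R.ε) (fun n => h.projective_of_addOf (R.mem_add n))
    (fun n => by rw [← Ψ.map_comp, R.d_comp_d, Functor.map_zero])
    (by rw [← Ψ.map_comp, R.d_comp_ε, Functor.map_zero]) (h.epi_map _ R.hom_surjective)
    (h.exact_map _ _ _ R.hom_exact_zero) (fun n => h.exact_map _ _ _ (R.hom_exact_succ n))
    fun n f hf => ?_
  have := h.isIso_counit_of_addOf (R.mem_add (n + 1))
  have := h.isIso_counit_of_addOf (R.mem_add (n + 2))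
  obtain ⟨f, rfl⟩ := exists_map_eq adj f
  obtain ⟨g, rfl⟩ := (R.exact_succ n).exists_desc_of_injective f
    (eq_of_map_eq adj (by rw [Ψ.map_comp, hf, Functor.map_zero]))
  exact ⟨Ψ.map g, (Ψ.map_comp _ _).symm⟩

/-- Apply Ψ to the canonical coresolution of Φ(Q). It stays exact because Φ(Q) ∈ Add(T) has no
higher Ext from T, it starts at ΨΦ(Q) ≅ Q, and maps from its terms to Ψ(J) are maps to J. -/
lemma nonempty_prodCoresolution [HasProducts.{v} A] [HasProducts.{v} B] {J : A} [Injective J]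
    (hJ : IsCoseparator J) (hT : IsWeaklyTilting T)
    (hinj : ∀ I : A, Injective I → IsIso (adj.counit.app I)) (Q : B) (hQ : Projective Q) :
    Nonempty (ProdCoresolution (Ψ.obj J) Q) := by
  have : Ψ.IsRightAdjoint := ⟨_, ⟨adj⟩⟩
  have : PreservesLimitsOfSize.{v, v} Ψ := adj.rightAdjoint_preservesLimits
  have := h.isIso_unit Q hQ
  set M := Φ.obj Q with hM
  have hTM : ∀ i, 0 < i → ExtVanishes T M i := fun i hi => by
    obtain ⟨I, ⟨r⟩⟩ := h.addOf_obj hQ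
    exact (hT I i hi).of_retract (Retract.refl _) r
  have hX (n : ℕ) : IsIso (adj.counit.app (cores J M n)) := hinj _ inferInstance
  -- The zeroth embedding, with its source read as M instead of `cosyzygy J M 0`.
  obtain ⟨ι₀, hι₀⟩ : ∃ ι₀ : M ⟶ cores J M 0, ι₀ = coresι J M 0 := ⟨_, rfl⟩
  have : Mono ι₀ := hι₀ ▸ mono_coresι M hJ 0
  have hDD (n : ℕ) : coresD J M n ≫ coresD J M (n + 1) = 0 := by
    simp [coresD, reassoc_of% coresι_π J M (n + 1)]
  have hιD : ι₀ ≫ coresD J M 0 = 0 := by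
    rw [hι₀]
    exact coresι_D J M 0
  have hw : (adj.unit.app Q ≫ Ψ.map ι₀) ≫ Ψ.map (coresD J M 0) = 0 := by
    rw [Category.assoc, ← Ψ.map_comp, hιD, Functor.map_zero, comp_zero]
  refine ⟨{ X := fun n => Ψ.obj (cores J M n)
            d := fun n => Ψ.map (coresD J M n)
            η := adj.unit.app Q ≫ Ψ.map ι₀
            mem_prod := fun n => ⟨_, ⟨Retract.ofIso (PreservesProduct.iso Ψ _)⟩⟩
            d_comp_d := fun n => by rw [← Ψ.map_comp, hDD, Functor.map_zero]
            η_comp_d := hw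
            mono_η := mono_comp _ _
            exact_zero := ?_
            exact_succ := fun n => h.exact_map _ _ _ fun t ht => exists_lift_coresD M hJ hTM t ht
            hom_surjective := fun f => ?_
            hom_exact_zero := fun f hf => ?_
            hom_exact_succ := fun n f hf => ?_ }⟩
  · refine exact_of_isSeparator h.separator _ fun p hp => ?_
    obtain ⟨q, hq⟩ := h.exists_lift (f := ι₀) p fun t ht =>
      hι₀ ▸ exists_lift_coresι M hJ t (ht _ _ hp)
    exact ⟨q ≫ inv (adj.unit.app Q), by simpa using hq⟩
  · refine ⟨Ψ.map (Injective.factorThru ((adj.homEquiv _ _).symm f) ι₀), ?_⟩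
    rw [Category.assoc, ← Ψ.map_comp, Injective.comp_factorThru, ← adj.homEquiv_unit,
      Equiv.apply_symm_apply]
  · obtain ⟨f, rfl⟩ := exists_map_eq adj f
    have : IsIso (adj.counit.app M) := isIso_counit_obj adj Q
    have hf' : ι₀ ≫ f = 0 := eq_of_map_eq adj (by
      rw [Ψ.map_comp, ← cancel_epi (adj.unit.app Q), Functor.map_zero, comp_zero]
      rwa [Category.assoc] at hf)
    obtain ⟨g, rfl⟩ := exists_desc_coresD M hJ f (hι₀ ▸ hf')
    exact ⟨Ψ.map g, (Ψ.map_comp _ _).symm⟩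
  · obtain ⟨f, rfl⟩ := exists_map_eq adj f
    have hf' : coresD J M n ≫ f = 0 :=
      eq_of_map_eq adj (by rw [Ψ.map_comp, hf, Functor.map_zero])
    obtain ⟨g, rfl⟩ := exists_desc_coresD M hJ f (by
      rwa [coresD, Category.assoc, ← comp_zero (f := coresπ J M n), cancel_epi] at hf')
    exact ⟨Ψ.map g, (Ψ.map_comp _ _).symm⟩

lemma isIso_counit_of_injective (hT : IsInftyTilting T) (I : A) (hI : Injective I) :
    IsIso (adj.counit.app I) :=
  h.isIso_counit_of_addResolution (hT.2 I hI).2.some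

lemma isInftyCotilting [HasProducts.{v} A] [HasProducts.{v} B] {J : A} [Injective J]
    (hJ : IsCoseparator J) (hT : IsInftyTilting T) : IsInftyCotilting (Ψ.obj J) := by
  refine ⟨fun I i hi => ?_, fun Q (hQ : Projective Q) =>
    ⟨fun i hi => extVanishes_of_projective _ _ hi,
      h.nonempty_prodCoresolution hJ hT.1 (h.isIso_counit_of_injective hT) Q hQ⟩⟩
  have : PreservesLimitsOfSize.{v, v} Ψ := adj.rightAdjoint_preservesLimits
  -- Ψ preserves products, so the powers of Ψ(J) are images of the injectives J^I, which have
  -- Add(T)-resolutions.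
  have hI : Injective (∏ᶜ fun _ : I => J) := inferInstance
  exact (h.extVanishes_map (hT.2 _ hI).2.some hi).of_retract
    (Retract.ofIso (PreservesProduct.iso Ψ _).symm) (Retract.refl _)

end IsTiltingAdjunction

end Core

/-! ### Functors restricting to equivalences of full subcategories -/

namespace Identifies

variable {C D : Type*} [Category* C] [Category* D] {F : C ⥤ D} {P : ObjectProperty C}
  {Q : ObjectProperty D}

lemma exists_map_eq (h : Identifies F P Q) {X Y : C} (hX : P X) (hY : P Y)
    (f : F.obj X ⟶ F.obj Y) : ∃ g, F.map g = f := by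
  have := h.full
  obtain ⟨g, hg⟩ := Functor.map_surjective (P.ι ⋙ F)
    (X := (⟨X, hX⟩ : P.FullSubcategory)) (Y := (⟨Y, hY⟩ : P.FullSubcategory))
    (show (P.ι ⋙ F).obj ⟨X, hX⟩ ⟶ (P.ι ⋙ F).obj ⟨Y, hY⟩ from f)
  exact ⟨g.hom, hg⟩

lemma eq_of_map_eq (h : Identifies F P Q) {X Y : C} (hX : P X) (hY : P Y)
    {f g : X ⟶ Y} (hfg : F.map f = F.map g) : f = g := by
  have := h.faithful
  have := Functor.map_injective (P.ι ⋙ F)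
    (show (P.ι ⋙ F).map (ObjectProperty.homMk f : (⟨X, hX⟩ : P.FullSubcategory) ⟶ ⟨Y, hY⟩) =
      (P.ι ⋙ F).map (ObjectProperty.homMk g) from hfg)
  exact congrArg (fun k => k.hom) this

lemma of_bijective (h : ∀ X Y : C, P X → P Y →
      Function.Bijective fun f : X ⟶ Y => F.map f)
    (h' : ∀ Y : D, Q Y ↔ ∃ X : C, P X ∧ Nonempty (F.obj X ≅ Y)) : Identifies F P Q where
  full := ⟨fun {X Y} f => by
    obtain ⟨g, hg⟩ := (h _ _ X.property Y.property).surjective f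
    exact ⟨ObjectProperty.homMk g, hg⟩⟩
  faithful := ⟨fun {X Y} f g hfg => by
    ext
    exact (h _ _ X.property Y.property).injective hfg⟩
  mem_iff := h'

lemma bijective (h : Identifies F P Q) {X Y : C} (hX : P X) (hY : P Y) :
    Function.Bijective fun f : X ⟶ Y => F.map f :=
  ⟨fun _ _ => h.eq_of_map_eq hX hY, fun f => h.exists_map_eq hX hY f⟩

end Identifies

section Adjunction

variable {A B : Type*} [Category* A] [Category* B] {Φ : B ⥤ A} {Ψ : A ⥤ B} (adj : Φ ⊣ Ψ)

lemma bijective_map_of_isIso_unit (P Q : B) [IsIso (adj.unit.app Q)] :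
    Function.Bijective fun f : P ⟶ Q => Φ.map f := by
  have h (f : P ⟶ Q) : adj.homEquiv _ _ (Φ.map f) = f ≫ adj.unit.app Q := by
    rw [adj.homEquiv_unit, ← adj.unit_naturality]
  refine ⟨fun f g hfg => ?_, fun f => ⟨adj.homEquiv _ _ f ≫ inv (adj.unit.app Q), ?_⟩⟩
  · rw [← cancel_mono (adj.unit.app Q), ← h, ← h]
    exact congrArg _ hfg
  · apply (adj.homEquiv _ _).injective
    rw [h, Category.assoc, IsIso.inv_hom_id, Category.comp_id]

end Adjunction

lemma addOf_self {C : Type u} [Category.{v} C] [HasCoproducts.{v} C] (T : C) : AddOf T T :=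
  ⟨PUnit, ⟨⟨Sigma.ι (fun _ : PUnit => T) PUnit.unit, Sigma.desc fun _ => 𝟙 T, by simp⟩⟩⟩

lemma addOf_of_iso {C : Type u} [Category.{v} C] [HasCoproducts.{v} C] {T X Y : C}
    (h : AddOf T X) (i : Y ≅ X) : AddOf T Y :=
  h.imp fun _ => Nonempty.map fun r => (Retract.ofIso i).trans r

namespace IsTiltingAdjunction

variable {A : Type*} [Category.{v} A] {B : Type*} [Category.{v} B] [Abelian B]
  [HasCoproducts.{v} A] {Φ : B ⥤ A} {Ψ : A ⥤ B} {adj : Φ ⊣ Ψ} {T : A} {P : B}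

/-- A tilting adjunction from the conditions in the definition of `TiltsTo`. -/
lemma of_identifies (h : Identifies Φ (projectives B) (AddOf T)) (hP : Projective P)
    (hP' : IsSeparator P) (i : P ≅ Ψ.obj T) : IsTiltingAdjunction adj T P := by
  have hu (Q : B) (hQ : Projective Q) : IsIso (adj.unit.app Q) := by
    refine isIso_of_isSeparator hP' _ ?_
    -- Composing with the unit is the action of Φ followed by the adjunction bijection, so it is
    -- bijective on maps from the separator P.
    have h' : (fun p : P ⟶ Q => p ≫ adj.unit.app Q) =
        adj.homEquiv _ _ ∘ fun p : P ⟶ Q => Φ.map p := by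
      ext p
      rw [Function.comp, adj.homEquiv_unit, ← adj.unit_naturality]
    exact Eq.mpr (congrArg Function.Bijective h')
      ((adj.homEquiv _ _).bijective.comp (h.bijective hP hQ))
  refine ⟨hP, hP', hu, ?_⟩
  -- T ≅ Φ(Q) for some projective Q, and then Q ≅ ΨΦ(Q) ≅ Ψ(T) ≅ P.
  obtain ⟨Q, hQ, ⟨j⟩⟩ := (h.mem_iff T).1 (addOf_self T)
  have := hu Q hQ
  exact ⟨j.symm ≪≫ Φ.mapIso (asIso (adj.unit.app Q) ≪≫ Ψ.mapIso j ≪≫ i.symm)⟩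

lemma identifies [Abelian A] [HasCoproducts.{v} B] (h : IsTiltingAdjunction adj T P) :
    Identifies Φ (projectives B) (AddOf T) := by
  refine Identifies.of_bijective (fun X Y hX hY => ?_) fun Y => ⟨fun hY => ?_, ?_⟩
  · have := h.isIso_unit Y hY
    exact bijective_map_of_isIso_unit adj X Y
  · have := h.isIso_counit_of_addOf hY
    exact ⟨Ψ.obj Y, h.projective_of_addOf hY, ⟨asIso (adj.counit.app Y)⟩⟩
  · rintro ⟨X, hX, ⟨i⟩⟩
    exact addOf_of_iso (h.addOf_obj hX) i.symm

end IsTiltingAdjunction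

lemma projective_unop {C : Type*} [Category* C] {X : Cᵒᵖ} (hX : Injective X) :
    Projective X.unop :=
  inferInstance

lemma injective_unop {C : Type*} [Category* C] {X : Cᵒᵖ} (hX : Projective X) :
    Injective X.unop :=
  inferInstance

/-! ### Passage to the opposite category -/

section Opposite

variable {C : Type u} [Category.{v} C] [HasProducts.{v} C] [HasCoproducts.{v} Cᵒᵖ]

lemma addOf_op {W X : C} (h : ProdOf W X) : AddOf (op W) (op X) := by
  obtain ⟨I, ⟨r⟩⟩ := h
  exact ⟨I, ⟨r.op.trans (Retract.ofIso (opProductIsoCoproduct _))⟩⟩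

lemma addOf_op_iff {W : C} {X : Cᵒᵖ} : AddOf (op W) X ↔ ProdOf W X.unop := by
  refine ⟨?_, addOf_op⟩
  rintro ⟨I, ⟨r⟩⟩
  let r' := r.trans (Retract.ofIso (opProductIsoCoproduct fun _ : I => W).symm)
  exact ⟨I, ⟨⟨r'.r.unop, r'.i.unop, Quiver.Hom.op_inj r'.retract⟩⟩⟩

variable [Abelian C]

lemma isWeaklyTilting_op [EnoughProjectives C] {W : C} (h : IsWeaklyCotilting W) :
    IsWeaklyTilting (op W) := fun I i hi =>
  ((extVanishes_op_iff_of_enoughProjectives W hi _).2 (h I i hi)).of_retract (Retract.refl _)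
    (Retract.ofIso (opProductIsoCoproduct fun _ : I => W).symm)

/-- The resolution in the opposite category given by a coresolution. -/
def ProdCoresolution.op {W F : C} (R : ProdCoresolution W F) :
    AddResolution (Opposite.op W) (Opposite.op F) where
  X n := Opposite.op (R.X n)
  d n := (R.d n).op
  ε := R.η.op
  mem_add n := addOf_op (R.mem_prod n)
  d_comp_d n := Quiver.Hom.unop_inj (R.d_comp_d n)
  d_comp_ε := Quiver.Hom.unop_inj R.η_comp_d
  epi_ε := have := R.mono_η; inferInstance
  exact_zero := R.exact_zero.op
  exact_succ n := (R.exact_succ n).op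
  hom_surjective f := (R.hom_surjective f.unop).imp' Quiver.Hom.op fun _ h =>
    Quiver.Hom.unop_inj h
  hom_exact_zero f hf := (R.hom_exact_zero f.unop (Quiver.Hom.op_inj hf)).imp' Quiver.Hom.op
    fun _ h => Quiver.Hom.unop_inj h
  hom_exact_succ n f hf := (R.hom_exact_succ n f.unop (Quiver.Hom.op_inj hf)).imp'
    Quiver.Hom.op fun _ h => Quiver.Hom.unop_inj h

/-- Ext into an injective vanishes automatically, so of the condition on injectives only the
resolution has to be dualised. -/
lemma isInftyTilting_op [EnoughProjectives C] {W : C} (h : IsInftyCotilting W) :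
    IsInftyTilting (op W) :=
  ⟨isWeaklyTilting_op h.1, fun I (hI : Injective I) =>
    ⟨fun _ hi => extVanishes_of_injective _ _ hi,
      (h.2 I.unop (projective_unop hI)).2.map ProdCoresolution.op⟩⟩

end Opposite

section OppositeTilting

variable {C : Type u} [Category.{v} C] [HasCoproducts.{v} C] [HasProducts.{v} Cᵒᵖ]

lemma prodOf_op {T X : C} (h : AddOf T X) : ProdOf (op T) (op X) := by
  obtain ⟨I, ⟨r⟩⟩ := h
  exact ⟨I, ⟨r.op.trans (Retract.ofIso (opCoproductIsoProduct _))⟩⟩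

variable [Abelian C]

lemma isWeaklyCotilting_op [EnoughInjectives C] {T : C} (h : IsWeaklyTilting T) :
    IsWeaklyCotilting (op T) := fun I i hi =>
  ((extVanishes_op_iff_of_enoughInjectives T hi _).2 (h I i hi)).of_retract
    (Retract.ofIso (opCoproductIsoProduct fun _ : I => T).symm) (Retract.refl _)

/-- The coresolution in the opposite category given by a resolution. -/
def AddResolution.op {T E : C} (R : AddResolution T E) :
    ProdCoresolution (Opposite.op T) (Opposite.op E) where
  X n := Opposite.op (R.X n)
  d n := (R.d n).op
  η := R.ε.op
  mem_prod n := prodOf_op (R.mem_add n)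
  d_comp_d n := Quiver.Hom.unop_inj (R.d_comp_d n)
  η_comp_d := Quiver.Hom.unop_inj R.d_comp_ε
  mono_η := have := R.epi_ε; inferInstance
  exact_zero := R.exact_zero.op
  exact_succ n := (R.exact_succ n).op
  hom_surjective f := (R.hom_surjective f.unop).imp' Quiver.Hom.op fun _ h =>
    Quiver.Hom.unop_inj h
  hom_exact_zero f hf := (R.hom_exact_zero f.unop (Quiver.Hom.op_inj hf)).imp' Quiver.Hom.op
    fun _ h => Quiver.Hom.unop_inj h
  hom_exact_succ n f hf := (R.hom_exact_succ n f.unop (Quiver.Hom.op_inj hf)).imp'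
    Quiver.Hom.op fun _ h => Quiver.Hom.unop_inj h

lemma isInftyCotilting_op [EnoughInjectives C] {T : C} (h : IsInftyTilting T) :
    IsInftyCotilting (op T) :=
  ⟨isWeaklyCotilting_op h.1, fun I (hI : Projective I) =>
    ⟨fun _ hi => extVanishes_of_projective _ _ hi,
      (h.2 I.unop (injective_unop hI)).2.map AddResolution.op⟩⟩

end OppositeTilting

/-- The opposite tilting datum of a cotilting datum. -/
def CotiltingDatum.op (b : CotiltingDatum.{v}) : TiltingDatum.{v} where
  A := b.Bᵒᵖ
  J := Opposite.op b.P
  T := Opposite.op b.W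
  injective := have := b.projective; inferInstance
  cogenerator := (isCoseparator_op_iff _).2 b.generator
  tilting :=
    have := b.projective
    have := enoughProjectives_of_isSeparator b.generator
    isInftyTilting_op b.cotilting

/-- The opposite cotilting datum of a tilting datum. -/
def TiltingDatum.op (a : TiltingDatum.{v}) : CotiltingDatum.{v} where
  B := a.Aᵒᵖ
  P := Opposite.op a.J
  W := Opposite.op a.T
  projective := have := a.injective; inferInstance
  generator := (isSeparator_op_iff _).2 a.cogenerator
  cotilting :=
    have := a.injective
    have := enoughInjectives_of_isCoseparator a.cogenerator
    isInftyCotilting_op a.tilting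

/-- The tilting datum `a` corresponds to the cotilting datum `b` under an adjunction `Φ ⊣ Ψ` that
is an equivalence both on the projective objects of `B` and on the injective objects of `A`. -/
def Corresponds (a : TiltingDatum.{v}) (b : CotiltingDatum.{v}) : Prop :=
  ∃ (Φ : b.B ⥤ a.A) (Ψ : a.A ⥤ b.B) (adj : Φ ⊣ Ψ),
    (∀ Q : b.B, Projective Q → IsIso (adj.unit.app Q)) ∧
    (∀ I : a.A, Injective I → IsIso (adj.counit.app I)) ∧
    Nonempty (a.T ≅ Φ.obj b.P) ∧ Nonempty (b.W ≅ Ψ.obj a.J)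

/-! ### The self-dual correspondence and its invariance -/

lemma corresponds_of_identifies {a : TiltingDatum.{v}} {b : CotiltingDatum.{v}} {Φ : b.B ⥤ a.A}
    {Ψ : a.A ⥤ b.B} (adj : Φ ⊣ Ψ) (h : Identifies Φ (projectives b.B) (AddOf a.T))
    (i : b.P ≅ Ψ.obj a.T) (j : b.W ≅ Ψ.obj a.J) : Corresponds a b :=
  have hadj : IsTiltingAdjunction adj a.T b.P := .of_identifies h b.projective b.generator i
  ⟨Φ, Ψ, adj, hadj.isIso_unit, hadj.isIso_counit_of_injective a.tilting, hadj.iso, ⟨j⟩⟩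

lemma TiltsTo.corresponds {a : TiltingDatum.{v}} {b : CotiltingDatum.{v}} (h : TiltsTo a b) :
    Corresponds a b := by
  obtain ⟨Φ, Ψ, -, ⟨adj⟩, -, h, ⟨i⟩, ⟨j⟩⟩ := h
  exact corresponds_of_identifies adj h i j

lemma Identifies.op {A B : Type*} [Category.{v} A] [Category.{v} B] [Abelian A] [Abelian B]
    [HasProducts.{v} B] [HasCoproducts.{v} Bᵒᵖ] {Ψ : A ⥤ B} {W : B}
    (h : Identifies Ψ (injectives A) (ProdOf W)) :
    Identifies Ψ.op (projectives Aᵒᵖ) (AddOf (Opposite.op W)) := by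
  refine Identifies.of_bijective (fun X Y (hX : Projective X) (hY : Projective Y) => ?_)
    fun Y => ?_
  · have hb := h.bijective (injective_unop hY)
      (injective_unop hX)
    refine ⟨fun f g hfg => Quiver.Hom.unop_inj (hb.injective (Quiver.Hom.op_inj hfg)),
      fun f => ?_⟩
    obtain ⟨g, hg⟩ := hb.surjective f.unop
    exact ⟨g.op, Quiver.Hom.unop_inj hg⟩
  · rw [addOf_op_iff, h.mem_iff]
    constructor
    · rintro ⟨X, (hX : Injective X), ⟨i⟩⟩
      exact ⟨Opposite.op X, inferInstanceAs (Projective _), ⟨i.symm.op⟩⟩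
    · rintro ⟨X, hX, ⟨i⟩⟩
      exact ⟨X.unop, injective_unop hX, ⟨i.symm.unop⟩⟩

/-- Duality exchanges the two adjoints, unit and counit, projectives and injectives, so the
conditions on the two sides trade places. -/
lemma corresponds_op_iff {a : TiltingDatum.{v}} {b : CotiltingDatum.{v}} :
    Corresponds b.op a.op ↔ Corresponds a b := by
  constructor
  · rintro ⟨Φ, Ψ, adj, h₁, h₂, ⟨i⟩, ⟨j⟩⟩
    refine ⟨Functor.unop (C := b.B) (D := a.A) Ψ, Functor.unop (C := a.A) (D := b.B) Φ,
      Adjunction.unop (C := b.B) (D := a.A) adj, fun Q hQ => ?_, fun I hI => ?_, ⟨j.symm.unop⟩,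
      ⟨i.symm.unop⟩⟩
    · have := h₂ (op Q) (inferInstanceAs (Injective (op Q)))
      exact (isIso_unop_iff (C := b.B) (adj.counit.app (op Q))).2 this
    · have := h₁ (op I) (inferInstanceAs (Projective (op I)))
      exact (isIso_unop_iff (C := a.A) (adj.unit.app (op I))).2 this
  · rintro ⟨Φ, Ψ, adj, h₁, h₂, ⟨i⟩, ⟨j⟩⟩
    refine ⟨Ψ.op, Φ.op, adj.op, fun Q hQ => ?_, fun I hI => ?_, ⟨j.symm.op⟩, ⟨i.symm.op⟩⟩
    · have := h₂ Q.unop (injective_unop hQ)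
      exact inferInstanceAs (IsIso (adj.counit.app Q.unop).op)
    · have := h₁ I.unop (projective_unop hI)
      exact inferInstanceAs (IsIso (adj.unit.app I.unop).op)

lemma CotiltsTo.corresponds {a : TiltingDatum.{v}} {b : CotiltingDatum.{v}}
    (h : CotiltsTo b a) : Corresponds a b := by
  obtain ⟨Ψ, Φ, -, ⟨adj⟩, -, h, ⟨i⟩, ⟨j⟩⟩ := h
  rw [← corresponds_op_iff]
  exact corresponds_of_identifies (a := b.op) (b := a.op) adj.op (Identifies.op h) i.symm.op
    j.symm.op

lemma Corresponds.of_equiv_right {a : TiltingDatum.{v}} {b b' : CotiltingDatum.{v}}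
    (h : Corresponds a b) (hb : b ≈ b') : Corresponds a b' := by
  obtain ⟨Φ, Ψ, adj, h₁, h₂, ⟨i⟩, ⟨j⟩⟩ := h
  obtain ⟨G, ⟨k⟩, ⟨l⟩⟩ := hb
  refine ⟨_, _, G.symm.toAdjunction.comp adj, fun Q hQ => ?_, fun I hI => ?_,
    ⟨i ≪≫ Φ.mapIso (G.unitIso.app _ ≪≫ G.inverse.mapIso k)⟩, ⟨l.symm ≪≫ G.functor.mapIso j⟩⟩
  · have := h₁ (G.inverse.obj Q) ((G.symm.map_projective_iff Q).2 hQ)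
    rw [Adjunction.comp_unit_app]
    exact inferInstanceAs (IsIso (G.counitIso.inv.app Q ≫
      G.functor.map (adj.unit.app (G.inverse.obj Q))))
  · have := h₂ I hI
    rw [Adjunction.comp_counit_app]
    exact inferInstanceAs (IsIso (Φ.map (G.unitIso.inv.app (Ψ.obj I)) ≫ adj.counit.app I))

lemma opOp_equiv (b : CotiltingDatum.{v}) : b.op.op ≈ b :=
  ⟨opOpEquivalence b.B, ⟨Iso.refl _⟩, ⟨Iso.refl _⟩⟩

lemma TiltingDatum.equiv_of_op_equiv {a a' : TiltingDatum.{v}} (h : a.op ≈ a'.op) : a ≈ a' := by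
  obtain ⟨G, ⟨i⟩, ⟨j⟩⟩ := h
  exact ⟨Equivalence.unop (C := a.A) (D := a'.A) G, ⟨i.symm.unop⟩, ⟨j.symm.unop⟩⟩

lemma TiltingDatum.op_equiv {a a' : TiltingDatum.{v}} (h : a ≈ a') : a.op ≈ a'.op := by
  obtain ⟨G, ⟨i⟩, ⟨j⟩⟩ := h
  exact ⟨G.op, ⟨i.symm.op⟩, ⟨j.symm.op⟩⟩

lemma Corresponds.of_equiv_left {a a' : TiltingDatum.{v}} {b : CotiltingDatum.{v}}
    (h : Corresponds a b) (ha : a ≈ a') : Corresponds a' b := by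
  rw [← corresponds_op_iff] at h ⊢
  exact h.of_equiv_right (TiltingDatum.op_equiv ha)

/-! ### Comparing the monads of two adjunctions -/

namespace MonadComparison

variable {A B C : Type*} [Category* A] [Category* B] [Category* C] {F₁ : C ⥤ B} {U₁ : B ⥤ C}
  (adj₁ : F₁ ⊣ U₁) {F₂ : C ⥤ A} {U₂ : A ⥤ C} (adj₂ : F₂ ⊣ U₂) {Ψ : A ⥤ B} (ρ : Ψ ⋙ U₁ ≅ U₂)

/-- The map between free objects induced by an isomorphism `Ψ ⋙ U₁ ≅ U₂`. -/
def freeMap (X : C) : F₁.obj X ⟶ Ψ.obj (F₂.obj X) :=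
  (adj₁.homEquiv _ _).symm (adj₂.unit.app X ≫ ρ.inv.app (F₂.obj X))

lemma unit_freeMap (X : C) : adj₁.unit.app X ≫ U₁.map (freeMap adj₁ adj₂ ρ X) =
    adj₂.unit.app X ≫ ρ.inv.app (F₂.obj X) :=
  (adj₁.homEquiv_unit _ _ _).symm.trans (Equiv.apply_symm_apply _ _)

lemma inv_naturality {M N : A} (f : M ⟶ N) :
    ρ.inv.app M ≫ U₁.map (Ψ.map f) = U₂.map f ≫ ρ.inv.app N :=
  (ρ.inv.naturality f).symm

lemma freeMap_naturality {X Y : C} (f : X ⟶ Y) :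
    F₁.map f ≫ freeMap adj₁ adj₂ ρ Y = freeMap adj₁ adj₂ ρ X ≫ Ψ.map (F₂.map f) := by
  apply (adj₁.homEquiv _ _).injective
  rw [adj₁.homEquiv_unit, adj₁.homEquiv_unit, U₁.map_comp, U₁.map_comp,
    ← Category.assoc, adj₁.unit_naturality, Category.assoc, unit_freeMap, ← Category.assoc,
    ← Category.assoc, unit_freeMap, ← adj₂.unit_naturality, Category.assoc, Category.assoc]
  exact congrArg _ (inv_naturality ρ (F₂.map f)).symm

lemma freeMap_counit (N : A) : freeMap adj₁ adj₂ ρ (U₂.obj N) ≫ Ψ.map (adj₂.counit.app N) =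
    F₁.map (ρ.inv.app N) ≫ adj₁.counit.app (Ψ.obj N) := by
  apply (adj₁.homEquiv _ _).injective
  rw [adj₁.homEquiv_unit, adj₁.homEquiv_unit, U₁.map_comp, U₁.map_comp, ← Category.assoc,
    unit_freeMap, ← Category.assoc, adj₁.unit_naturality, Category.assoc, Category.assoc]
  calc
    _ = adj₂.unit.app (U₂.obj N) ≫ U₂.map (adj₂.counit.app N) ≫ ρ.inv.app N :=
      congrArg _ (inv_naturality ρ (adj₂.counit.app N))
    _ = ρ.inv.app N ≫ 𝟙 (U₁.obj (Ψ.obj N)) := by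
      rw [← Category.assoc, adj₂.right_triangle_components]
      exact (Category.id_comp _).trans (Category.comp_id _).symm
    _ = _ := congrArg _ (adj₁.right_triangle_components _).symm

/-- The components of the morphism of monads. -/
def homApp (X : C) : U₁.obj (F₁.obj X) ⟶ U₂.obj (F₂.obj X) :=
  U₁.map (freeMap adj₁ adj₂ ρ X) ≫ ρ.hom.app (F₂.obj X)

lemma homApp_naturality {X Y : C} (f : X ⟶ Y) :
    U₁.map (F₁.map f) ≫ homApp adj₁ adj₂ ρ Y = homApp adj₁ adj₂ ρ X ≫ U₂.map (F₂.map f) := by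
  have h : U₁.map (Ψ.map (F₂.map f)) ≫ ρ.hom.app (F₂.obj Y) =
      ρ.hom.app (F₂.obj X) ≫ U₂.map (F₂.map f) := ρ.hom.naturality (F₂.map f)
  rw [homApp, homApp, ← Category.assoc, ← U₁.map_comp, freeMap_naturality, U₁.map_comp,
    Category.assoc, h, Category.assoc]

lemma unit_homApp (X : C) :
    adj₁.unit.app X ≫ homApp adj₁ adj₂ ρ X = adj₂.unit.app X := by
  rw [homApp, ← Category.assoc, unit_freeMap, Category.assoc, ρ.inv_hom_id_app]
  exact Category.comp_id _

/-- This compatibility with the canonical algebra structures yields both the multiplication law for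
`hom` and the comparison of algebras in `comparisonIso`. -/
lemma homApp_counit (N : A) : homApp adj₁ adj₂ ρ (U₂.obj N) ≫ U₂.map (adj₂.counit.app N) =
    U₁.map (F₁.map (ρ.inv.app N)) ≫ U₁.map (adj₁.counit.app (Ψ.obj N)) ≫ ρ.hom.app N := by
  have h : ρ.hom.app (F₂.obj (U₂.obj N)) ≫ U₂.map (adj₂.counit.app N) =
      U₁.map (Ψ.map (adj₂.counit.app N)) ≫ ρ.hom.app N :=
    (ρ.hom.naturality (adj₂.counit.app N)).symm
  rw [homApp, Category.assoc, h, ← Category.assoc, ← U₁.map_comp, freeMap_counit, U₁.map_comp,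
    Category.assoc]

/-- The morphism of monads induced by an isomorphism `Ψ ⋙ U₁ ≅ U₂`. -/
def hom : adj₁.toMonad ⟶ adj₂.toMonad where
  app X := homApp adj₁ adj₂ ρ X
  naturality _ _ f := homApp_naturality adj₁ adj₂ ρ f
  app_η X := unit_homApp adj₁ adj₂ ρ X
  app_μ X := by
    change U₁.map (adj₁.counit.app (F₁.obj X)) ≫ homApp adj₁ adj₂ ρ X =
      (U₁.map (F₁.map (homApp adj₁ adj₂ ρ X)) ≫ homApp adj₁ adj₂ ρ (U₂.obj (F₂.obj X))) ≫
        U₂.map (adj₂.counit.app (F₂.obj X))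
    rw [Category.assoc, homApp_counit, ← Category.assoc, ← U₁.map_comp, ← F₁.map_comp]
    nth_rw 2 [homApp]
    rw [Category.assoc, ρ.hom_inv_id_app]
    have h := adj₁.counit_naturality (freeMap adj₁ adj₂ ρ X)
    change _ = U₁.map (F₁.map (U₁.map (freeMap adj₁ adj₂ ρ X) ≫ 𝟙 _)) ≫ _
    rw [Category.comp_id, ← Category.assoc, ← U₁.map_comp, h, U₁.map_comp, Category.assoc, homApp]

/-- Compatibility of the comparison functors with the morphism of monads. -/
def comparisonIso : Monad.comparison adj₂ ⋙ Monad.algebraFunctorOfMonadHom (hom adj₁ adj₂ ρ) ≅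
    Ψ ⋙ Monad.comparison adj₁ :=
  NatIso.ofComponents (fun N => Monad.Algebra.isoMk (ρ.symm.app N) (by
    change U₁.map (F₁.map (ρ.inv.app N)) ≫ U₁.map (adj₁.counit.app (Ψ.obj N)) =
      (homApp adj₁ adj₂ ρ (U₂.obj N) ≫ U₂.map (adj₂.counit.app N)) ≫ ρ.inv.app N
    rw [homApp_counit, Category.assoc, Category.assoc, ρ.hom_inv_id_app]
    exact congrArg _ (Category.comp_id _).symm))
    fun f => Monad.Algebra.Hom.ext (ρ.inv.naturality f)

lemma isIso_hom [∀ X, IsIso (freeMap adj₁ adj₂ ρ X)] : IsIso (hom adj₁ adj₂ ρ) := by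
  have (X : C) : IsIso (((monadToFunctor C).map (hom adj₁ adj₂ ρ)).app X) :=
    inferInstanceAs (IsIso (U₁.map (freeMap adj₁ adj₂ ρ X) ≫ ρ.hom.app (F₂.obj X)))
  have : IsIso ((monadToFunctor C).map (hom adj₁ adj₂ ρ)) := NatIso.isIso_of_isIso_app _
  exact isIso_of_reflects_iso _ (monadToFunctor C)

lemma exists_equivalence [∀ X, IsIso (freeMap adj₁ adj₂ ρ X)] :
    ∃ G : adj₁.toMonad.Algebra ≌ adj₂.toMonad.Algebra,
      Nonempty ((Ψ ⋙ Monad.comparison adj₁) ⋙ G.functor ≅ Monad.comparison adj₂) := by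
  have := isIso_hom adj₁ adj₂ ρ
  let G := Monad.algebraEquivOfIsoMonads (asIso (hom adj₁ adj₂ ρ))
  exact ⟨G, ⟨Functor.isoWhiskerRight (comparisonIso adj₁ adj₂ ρ).symm G.functor ≪≫
    Functor.associator _ _ _ ≪≫ Functor.isoWhiskerLeft _ G.counitIso ≪≫
    Functor.rightUnitor _⟩⟩

/-- Both ΦF₁(X) and F₂(X) corepresent N ↦ Hom(X, U₂(N)), so the transpose c of the free map is
invertible by Yoneda; the free map is the unit followed by Ψ(c). -/
lemma isIso_freeMap {Φ : B ⥤ A} (adj : Φ ⊣ Ψ) (X : C) [IsIso (adj.unit.app (F₁.obj X))] :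
    IsIso (freeMap adj₁ adj₂ ρ X) := by
  let c : Φ.obj (F₁.obj X) ⟶ F₂.obj X := (adj.homEquiv _ _).symm (freeMap adj₁ adj₂ ρ X)
  have hc : adj.homEquiv _ _ c = freeMap adj₁ adj₂ ρ X := Equiv.apply_symm_apply _ _
  have key {N : A} (f : F₂.obj X ⟶ N) :
      adj₁.homEquiv _ _ (adj.homEquiv _ _ (c ≫ f)) = adj₂.homEquiv _ _ f ≫ ρ.inv.app N := by
    rw [adj.homEquiv_naturality_right, hc, adj₁.homEquiv_unit, U₁.map_comp, ← Category.assoc,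
      unit_freeMap, Category.assoc, inv_naturality, adj₂.homEquiv_unit, Category.assoc]
  have : IsIso c := by
    refine isIso_of_coyoneda_map_bijective c fun N => ⟨fun f g hfg => ?_, fun g => ?_⟩
    · apply (adj₂.homEquiv _ _).injective
      rw [← cancel_mono (ρ.inv.app N), ← key, ← key]
      exact congrArg _ (congrArg _ hfg)
    · refine ⟨(adj₂.homEquiv _ _).symm
        (adj₁.homEquiv _ _ (adj.homEquiv _ _ g) ≫ ρ.hom.app N), ?_⟩
      apply (adj.homEquiv _ _).injective
      apply (adj₁.homEquiv _ _).injective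
      change adj₁.homEquiv _ _ (adj.homEquiv _ _ (c ≫ _)) = _
      rw [key, Equiv.apply_symm_apply, Category.assoc, ρ.hom_inv_id_app]
      exact Category.comp_id _
  rw [← hc, adj.homEquiv_unit]
  infer_instance

end MonadComparison

/-! ### Monadicity of Hom(P, -) for a projective generator -/

section Monadicity

variable {B : Type u} [Category.{v} B] [Abelian B] {P : B}

lemma exists_lift_of_reflexive [Projective P] {X Y Z : B} {f g : X ⟶ Y} {s : Y ⟶ X}
    (hf : s ≫ f = 𝟙 Y) (hg : s ≫ g = 𝟙 Y) {π : Y ⟶ Z} (w : f ≫ π = g ≫ π)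
    (hπ : IsColimit (Cofork.ofπ π w)) {y y' : P ⟶ Y} (h : y ≫ π = y' ≫ π) :
    ∃ q : P ⟶ X, q ≫ f = y ∧ q ≫ g = y' := by
  have w' : (f - g) ≫ π = 0 := by rw [Preadditive.sub_comp, w, sub_self]
  have aux {Z' : B} {k : Y ⟶ Z'} (hk : (f - g) ≫ k = 0) : f ≫ k = g ≫ k := by
    rwa [Preadditive.sub_comp, sub_eq_zero] at hk
  have hc : (ShortComplex.mk (f - g) π w').Exact := ShortComplex.exact_of_g_is_cokernel _
    (CokernelCofork.IsColimit.ofπ π w'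
      (fun k hk => Cofork.IsColimit.desc hπ k (aux hk))
      (fun k hk => Cofork.IsColimit.π_desc' hπ k (aux hk))
      fun k hk m hm => Cofork.IsColimit.hom_ext hπ
        (hm.trans (Cofork.IsColimit.π_desc' hπ k (aux hk)).symm))
  obtain ⟨p, hp⟩ := hc.exists_lift_of_projective (y - y') (by
    rw [Preadditive.sub_comp, h, sub_self])
  rw [Preadditive.comp_sub] at hp
  -- The map p only satisfies pf − pg = y − y'. Corrections through the common section s replace its
  -- second component pg by y' and leave the difference unchanged.
  refine ⟨p - (p ≫ g) ≫ s + y' ≫ s, ?_, ?_⟩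
  · simp only [Preadditive.add_comp, Preadditive.sub_comp, Category.assoc, hf, Category.comp_id,
      hp, sub_add_cancel]
  · simp only [Preadditive.add_comp, Preadditive.sub_comp, Category.assoc, hg, Category.comp_id,
      sub_self, zero_add]

instance [Projective P] : Monad.PreservesColimitOfIsReflexivePair (coyoneda.obj (op P)) where
  out X Y f g _ := by
    obtain ⟨s, hf, hg⟩ := IsReflexivePair.common_section' (f := f) (g := g)
    refine preservesColimit_of_preserves_colimit_cocone (coequalizerIsCoequalizer f g)
      ((isColimitMapCoconeCoforkEquiv _ _).symm (Cofork.IsColimit.mk' _ fun t =>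
        ⟨↾ fun z : P ⟶ coequalizer f g =>
          -- The choice of lift is immaterial: by `exists_lift_of_reflexive` two lifts are the
          -- images under f and g of one map, and `t.π` identifies these.
          t.π (show P ⟶ Y from Projective.factorThru z (coequalizer.π f g)),
          ?_, fun {m} hm => ?_⟩))
    · ext (y : P ⟶ Y)
      obtain ⟨q, hq, hq'⟩ := exists_lift_of_reflexive hf hg _ (coequalizerIsCoequalizer f g)
        (Projective.factorThru_comp (y ≫ coequalizer.π f g) (coequalizer.π f g))
      have h := ConcreteCategory.congr_hom t.condition q
      change t.π (q ≫ f) = t.π (q ≫ g) at h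
      rw [hq, hq'] at h
      exact h
    · ext (z : P ⟶ coequalizer f g)
      have h := ConcreteCategory.congr_hom hm
        (show P ⟶ Y from Projective.factorThru z (coequalizer.π f g))
      refine Eq.trans ?_ h
      exact congrArg m (Projective.factorThru_comp z (coequalizer.π f g)).symm

/-- An abelian category with coproducts and a projective generator `P` is equivalent to the
category of algebras over the monad `X ↦ Hom(P, P^{(X)})`. -/
lemma isEquivalence_homFunctor [HasCoproducts.{v} B] [Projective P] (hP : IsSeparator P) :
    (homFunctor P).IsEquivalence := by
  -- In an abelian category a separator detects isomorphisms, the remaining hypothesis of the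
  -- reflexive monadicity theorem.
  have := (isDetector_iff_reflectsIsomorphisms_coyoneda_obj P).1 hP.isDetector
  exact (Monad.monadicOfHasPreservesReflexiveCoequalizersOfReflectsIsomorphisms
    (sigmaConstAdj P)).eqv

end Monadicity

section

variable {A B : Type*} [Category.{v} A] [Category.{v} B] {Φ : B ⥤ A} {Ψ : A ⥤ B}

/-- The isomorphism `Hom(P, Ψ(-)) ≅ Hom(T, -)` for `T ≅ Φ(P)`. -/
def coyonedaCompIso (adj : Φ ⊣ Ψ) {T : A} {P : B} (i : T ≅ Φ.obj P) :
    Ψ ⋙ coyoneda.obj (op P) ≅ coyoneda.obj (op T) :=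
  NatIso.ofComponents
    (fun N => ((adj.homEquiv P N).symm.trans (i.symm.homCongr (Iso.refl N))).toIso)
    fun {M N} f => by
      ext (p : P ⟶ Ψ.obj M)
      change i.hom ≫ (adj.homEquiv _ _).symm (p ≫ Ψ.map f) ≫ 𝟙 N =
        (i.hom ≫ (adj.homEquiv _ _).symm p ≫ 𝟙 M) ≫ f
      rw [adj.homEquiv_naturality_right_symm, Category.comp_id, Category.comp_id, Category.assoc]

/-- The functors represented by `W` and by its opposite agree. -/
def yonedaIsoCoyonedaOp (W : B) :
    𝟭 Bᵒᵖ ⋙ yoneda.obj W ≅ coyoneda.obj (op (op W)) :=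
  NatIso.ofComponents (fun N => (opEquiv (op W) N).symm.toIso) fun _ => rfl

end

lemma Corresponds.exists_adjunction {a : TiltingDatum.{v}} {b : CotiltingDatum.{v}}
    (h : Corresponds a b) : ∃ (Φ : b.B ⥤ a.A) (Ψ : a.A ⥤ b.B) (adj : Φ ⊣ Ψ),
      IsTiltingAdjunction adj a.T b.P ∧ Nonempty (b.W ≅ Ψ.obj a.J) := by
  obtain ⟨Φ, Ψ, adj, h₁, -, i, j⟩ := h
  exact ⟨Φ, Ψ, adj, ⟨b.projective, b.generator, h₁, i⟩, j⟩

/-- B is equivalent to the algebras over the monad of P. The unit is invertible on each P^(X), so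
this monad is isomorphic to that of T. -/
lemma Corresponds.tiltsTo {a : TiltingDatum.{v}} {b : CotiltingDatum.{v}} (h : Corresponds a b) :
    TiltsTo a b := by
  obtain ⟨Φ, Ψ, adj, hadj, j⟩ := h.exists_adjunction
  obtain ⟨i⟩ := hadj.iso
  have := b.projective
  have hθ (X : Type v) : IsIso (MonadComparison.freeMap (sigmaConstAdj b.P) (sigmaConstAdj a.T)
      (coyonedaCompIso adj i) X) := by
    have := hadj.isIso_unit ((sigmaConst.obj b.P).obj X)
      (inferInstanceAs (Projective (∐ fun _ : X => b.P)))
    exact MonadComparison.isIso_freeMap _ _ _ adj X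
  obtain ⟨G, ⟨k⟩⟩ := MonadComparison.exists_equivalence (sigmaConstAdj b.P) (sigmaConstAdj a.T)
    (coyonedaCompIso adj i)
  have := isEquivalence_homFunctor b.generator
  have := hadj.isIso_unit b.P b.projective
  exact ⟨Φ, Ψ, (homFunctor b.P).asEquivalence.trans G, ⟨adj⟩, ⟨k⟩, hadj.identifies,
    ⟨asIso (adj.unit.app b.P) ≪≫ Ψ.mapIso i.symm⟩, j⟩

lemma Identifies.unop {A B : Type*} [Category.{v} A] [Category.{v} B] [Abelian A] [Abelian B]
    [HasProducts.{v} B] [HasCoproducts.{v} Bᵒᵖ] {F : Aᵒᵖ ⥤ Bᵒᵖ} {W : B}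
    (h : Identifies F (projectives Aᵒᵖ) (AddOf (Opposite.op W))) :
    Identifies F.unop (injectives A) (ProdOf W) := by
  refine Identifies.of_bijective (fun X Y (hX : Injective X) (hY : Injective Y) => ?_)
    fun Y => ?_
  · have hb := h.bijective
      (show Projective (Opposite.op Y) from inferInstance)
      (show Projective (Opposite.op X) from inferInstance)
    refine ⟨fun f g hfg => Quiver.Hom.op_inj (hb.injective (Quiver.Hom.unop_inj hfg)),
      fun f => ?_⟩
    obtain ⟨g, hg⟩ := hb.surjective f.op
    exact ⟨g.unop, Quiver.Hom.op_inj hg⟩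
  · rw [← Opposite.unop_op Y, ← addOf_op_iff, h.mem_iff]
    constructor
    · rintro ⟨X, hX, ⟨i⟩⟩
      exact ⟨X.unop, injective_unop hX, ⟨i.symm.unop⟩⟩
    · rintro ⟨X, (hX : Injective X), ⟨i⟩⟩
      exact ⟨Opposite.op X, inferInstanceAs (Projective _), ⟨i.symm.op⟩⟩

/-- The monad of powers of W is the monad of copowers of `op W`, by the comparison above for the
identity adjunction. -/
lemma exists_equivalence_pi {B : Type u} [Category.{v} B] [HasProducts.{v} B]
    [HasCoproducts.{v} Bᵒᵖ] (W : B) :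
    ∃ G : (piConstAdj W).toMonad.Algebra ≌ (sigmaConstAdj (op W)).toMonad.Algebra,
      Nonempty ((𝟭 _ ⋙ Monad.comparison (piConstAdj W)) ⋙ G.functor ≅
        Monad.comparison (sigmaConstAdj (op W))) := by
  have (X : Type v) : IsIso (MonadComparison.freeMap (piConstAdj W) (sigmaConstAdj (op W))
      (yonedaIsoCoyonedaOp W) X) :=
    have : IsIso ((Adjunction.id (C := Bᵒᵖ)).unit.app ((piConst.obj W).rightOp.obj X)) :=
      inferInstanceAs (IsIso (𝟙 _))
    MonadComparison.isIso_freeMap _ _ _ Adjunction.id X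
  exact MonadComparison.exists_equivalence _ _ (yonedaIsoCoyonedaOp W)

lemma Corresponds.cotiltsTo {a : TiltingDatum.{v}} {b : CotiltingDatum.{v}}
    (h : Corresponds a b) : CotiltsTo b a := by
  obtain ⟨Φ, Ψ, E, ⟨adj⟩, ⟨k⟩, hΦ, ⟨i⟩, ⟨j⟩⟩ := (corresponds_op_iff.2 h).tiltsTo
  obtain ⟨G, ⟨l⟩⟩ := exists_equivalence_pi b.W
  have k' : (Ψ ⋙ E.functor) ⋙ G.inverse ≅ Monad.comparison (piConstAdj b.W) :=
    Functor.isoWhiskerRight (k ≪≫ l.symm) G.inverse ≪≫ Functor.associator _ _ _ ≪≫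
      Functor.isoWhiskerLeft _ G.unitIso.symm ≪≫ Functor.rightUnitor _ ≪≫ Functor.leftUnitor _
  let E' : a.Aᵒᵖ ≌ (piConstAdj b.W).toMonad.Algebra := E.trans G.symm
  refine ⟨Functor.unop (C := a.A) (D := b.B) Φ, Functor.unop (C := b.B) (D := a.A) Ψ, E'.rightOp,
    ⟨Adjunction.unop (C := b.B) (D := a.A) adj⟩, ?_, Identifies.unop hΦ, ⟨i.symm.unop⟩,
    ⟨j.symm.unop⟩⟩
  exact ⟨NatIso.ofComponents (fun N => (k'.app (op N)).symm.op) fun f =>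
    Quiver.Hom.unop_inj (k'.inv.naturality f.op).symm⟩

/-! ### Free algebras as projective generators -/

namespace MonadAlgebra

variable {T : Monad (Type v)}

lemma free_hom_ext {X : Type v} {M : T.Algebra} {f g : T.free.obj X ⟶ M}
    (h : ∀ i, f.f (T.η.app X i) = g.f (T.η.app X i)) : f = g := by
  apply (T.adj.homEquiv _ _).injective
  rw [T.adj.homEquiv_unit, T.adj.homEquiv_unit]
  ext i
  exact h i

lemma isSeparator_free : IsSeparator (T.free.obj PUnit) := by
  rw [isSeparator_def]
  intro M N f g h
  refine hom_ext fun m => ?_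
  have h' := h (freeHom M fun _ => m)
  rw [freeHom_comp, freeHom_comp] at h'
  exact freeHom_injective N h' PUnit.unit

/-- A projective algebra is a retract of a free algebra. -/
lemma exists_retract_free (Q : T.Algebra) [Projective Q] :
    ∃ X : Type v, Nonempty (Retract Q (T.free.obj X)) := by
  have : Epi (freeHom Q (X := Q.A) id) := epi_of_surjective _ fun n => ⟨_, freeHom_η Q id n⟩
  exact ⟨Q.A, ⟨⟨Projective.factorThru (𝟙 Q) (freeHom Q id), freeHom Q id,
    Projective.factorThru_comp _ _⟩⟩⟩

variable [AdditiveMonad T]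

instance (X : Type v) : Projective (T.free.obj X) where
  factors {M N} g f _ := by
    choose s hs using fun i => surjective_of_epi f (g.f (T.η.app X i))
    exact ⟨freeHom _ s, free_hom_ext fun i =>
      (congrArg f.f (freeHom_η M s i)).trans (hs i)⟩

end MonadAlgebra

open MonadAlgebra

section Adjunction

variable {A B : Type*} [Category* A] [Category* B] {Φ : B ⥤ A} {Ψ : A ⥤ B} (adj : Φ ⊣ Ψ)

lemma isIso_counit_of_bijective (M : A)
    (h : ∀ N : A, Function.Bijective fun f : M ⟶ N => Ψ.map f) : IsIso (adj.counit.app M) := by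
  refine isIso_of_coyoneda_map_bijective _ fun N => ?_
  rw [← Function.Bijective.of_comp_iff' (adj.homEquiv _ _).bijective]
  refine Eq.mpr (congrArg Function.Bijective ?_) (h N)
  ext1 f
  refine (adj.homEquiv_naturality_right (adj.counit.app M) f).trans ?_
  rw [adj.homEquiv_unit, adj.right_triangle_components]
  exact Category.id_comp _

lemma isIso_unit_obj (M : A) [IsIso (adj.counit.app M)] :
    IsIso (adj.unit.app (Ψ.obj M)) := by
  have h := adj.right_triangle_components M
  have h' : IsIso (𝟙 (Ψ.obj M)) := inferInstance
  exact IsIso.of_isIso_fac_right (hh := h') h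

end Adjunction

/-! ### Existence and uniqueness of the corresponding datum -/

section Existence

variable {A : Type u} [Category.{v} A] [HasCoproducts.{v} A] (T : A)

/-- Hom(T, T^(X)) is the free algebra on X, so both sides are families of maps T → N indexed by X.
-/
lemma bijective_homFunctor_map (X : Type v) (N : A) :
    Function.Bijective fun f : (∐ fun _ : X => T) ⟶ N => (homFunctor T).map f := by
  refine ⟨fun f g h => Sigma.hom_ext _ _ fun i => ?_, fun φ => ?_⟩
  · exact ConcreteCategory.congr_hom (congrArg Monad.Algebra.Hom.f h)
      (Sigma.ι (fun _ : X => T) i)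
  · refine ⟨Sigma.desc fun i => φ.f (Sigma.ι (fun _ : X => T) i), ?_⟩
    exact free_hom_ext (T := (sigmaConstAdj T).toMonad) (X := X) fun i => Sigma.ι_desc _ _

variable [HasCoequalizers A]

/-- The left adjoint of `Hom(T, -)` as a functor to the category of algebras. -/
def homFunctorAdj : Monad.MonadicityInternal.leftAdjointComparison (sigmaConstAdj T) ⊣
    homFunctor T :=
  Monad.MonadicityInternal.comparisonAdjunction (sigmaConstAdj T)

instance (X : Type v) : IsIso ((homFunctorAdj T).counit.app (∐ fun _ : X => T)) :=
  isIso_counit_of_bijective _ _ (bijective_homFunctor_map T X)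

instance (X : Type v) :
    IsIso ((homFunctorAdj T).unit.app ((homFunctor T).obj (∐ fun _ : X => T))) :=
  isIso_unit_obj _ _

end Existence

/-- The counit is invertible at T^(X), hence the unit is invertible at the free algebra Hom(T,
T^(X)); every projective algebra is a retract of a free one. -/
lemma isTiltingAdjunction_homFunctorAdj {A : Type u} [Category.{v} A] [Abelian A]
    [HasCoproducts.{v} A] (T : A) : IsTiltingAdjunction (homFunctorAdj T) T
      ((sigmaConstAdj T).toMonad.free.obj PUnit) where
  projective := inferInstance
  separator := isSeparator_free
  isIso_unit Q hQ := by
    obtain ⟨X, ⟨r⟩⟩ := exists_retract_free Q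
    have : IsIso ((homFunctorAdj T).unit.app ((sigmaConstAdj T).toMonad.free.obj X)) :=
      inferInstanceAs
        (IsIso ((homFunctorAdj T).unit.app ((homFunctor T).obj (∐ fun _ : X => T))))
    exact isIso_app_of_retract (homFunctorAdj T).unit r
  iso := ⟨(coproductUniqueIso fun _ : PUnit => T).symm ≪≫
    (asIso ((homFunctorAdj T).counit.app (∐ fun _ : PUnit => T))).symm⟩

lemma TiltingDatum.exists_corresponds (a : TiltingDatum.{v}) :
    ∃ b : CotiltingDatum.{v}, Corresponds a b := by
  have h := isTiltingAdjunction_homFunctorAdj a.T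
  have := a.injective
  let b : CotiltingDatum.{v} :=
    { B := SigmaCat a.T
      P := (sigmaConstAdj a.T).toMonad.free.obj PUnit
      W := (homFunctor a.T).obj a.J
      projective := h.projective
      generator := h.separator
      cotilting := h.isInftyCotilting a.cogenerator a.tilting }
  exact ⟨b, _, _, homFunctorAdj a.T, h.isIso_unit, h.isIso_counit_of_injective a.tilting, h.iso,
    ⟨Iso.refl _⟩⟩

lemma CotiltingDatum.exists_corresponds (b : CotiltingDatum.{v}) :
    ∃ a : TiltingDatum.{v}, Corresponds a b := by
  obtain ⟨c, hc⟩ := b.op.exists_corresponds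
  exact ⟨c.op, (corresponds_op_iff.2 hc).of_equiv_right (opOp_equiv b)⟩

/-- Both categories are equivalent to σ_T(A) compatibly with their functors Ψ, and the distinguished
objects are the images of T and J. -/
lemma Corresponds.equiv_right {a : TiltingDatum.{v}} {b b' : CotiltingDatum.{v}}
    (h : Corresponds a b) (h' : Corresponds a b') : b ≈ b' := by
  obtain ⟨Φ, Ψ, E, -, ⟨k⟩, -, ⟨i⟩, ⟨j⟩⟩ := h.tiltsTo
  obtain ⟨Φ', Ψ', E', -, ⟨k'⟩, -, ⟨i'⟩, ⟨j'⟩⟩ := h'.tiltsTo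
  let c (N : a.A) : (E.trans E'.symm).functor.obj (Ψ.obj N) ≅ Ψ'.obj N :=
    E'.inverse.mapIso ((k ≪≫ k'.symm).app N) ≪≫ (E'.unitIso.app _).symm
  exact ⟨E.trans E'.symm, ⟨(E.trans E'.symm).functor.mapIso i ≪≫ c _ ≪≫ i'.symm⟩,
    ⟨(E.trans E'.symm).functor.mapIso j ≪≫ c _ ≪≫ j'.symm⟩⟩

lemma Corresponds.equiv_left {a a' : TiltingDatum.{v}} {b : CotiltingDatum.{v}}
    (h : Corresponds a b) (h' : Corresponds a' b) : a ≈ a' :=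
  TiltingDatum.equiv_of_op_equiv
    ((corresponds_op_iff.2 h).equiv_right (corresponds_op_iff.2 h'))

lemma tiltsTo_iff {a : TiltingDatum.{v}} {b : CotiltingDatum.{v}} :
    TiltsTo a b ↔ Corresponds a b :=
  ⟨TiltsTo.corresponds, Corresponds.tiltsTo⟩

lemma cotiltsTo_iff {a : TiltingDatum.{v}} {b : CotiltingDatum.{v}} :
    CotiltsTo b a ↔ Corresponds a b :=
  ⟨CotiltsTo.corresponds, Corresponds.cotiltsTo⟩

/-- A relation that is total, surjective, and unique and invariant up to equivalence on both sides
induces a bijection between the quotients. -/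
lemma exists_equiv_of_rel {α β : Type*} [sα : Setoid α] [sβ : Setoid β] {R : α → β → Prop}
    (hα : ∀ a, ∃ b, R a b) (hβ : ∀ b, ∃ a, R a b)
    (hl : ∀ {a a' b}, R a b → (a ≈ a' ↔ R a' b)) (hr : ∀ {a b b'}, R a b → (b ≈ b' ↔ R a b')) :
    ∃ e : _root_.Quotient sα ≃ _root_.Quotient sβ,
      ∀ a b, e ⟦a⟧ = ⟦b⟧ ↔ R a b := by
  choose f hf using hα
  let e : _root_.Quotient sα → _root_.Quotient sβ :=
    _root_.Quotient.map f fun a a' h => (hr (hf a)).2 ((hl (hf a')).1 (Setoid.symm h))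
  have he (a b) : e ⟦a⟧ = ⟦b⟧ ↔ R a b := _root_.Quotient.eq.trans (hr (hf a))
  refine ⟨Equiv.ofBijective e ⟨?_, ?_⟩, he⟩
  · rintro ⟨a⟩ ⟨a'⟩ h
    have h' : R a (f a') := (he a (f a')).1 h
    exact _root_.Quotient.sound ((hl h').2 (hf a'))
  · rintro ⟨b⟩
    obtain ⟨a, ha⟩ := hβ b
    exact ⟨⟦a⟧, (he a b).2 ha⟩

end TiltingCotilting

end

theorem corollary2p5 :
    ∃ e : Quotient TiltingCotilting.TiltingDatum.setoid.{v} ≃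
        Quotient TiltingCotilting.CotiltingDatum.setoid.{v},
      (∀ (a : TiltingCotilting.TiltingDatum.{v}) (b : TiltingCotilting.CotiltingDatum.{v}),
        e (Quotient.mk _ a) = Quotient.mk _ b ↔ TiltingCotilting.TiltsTo a b) ∧
      (∀ (b : TiltingCotilting.CotiltingDatum.{v}) (a : TiltingCotilting.TiltingDatum.{v}),
        e.symm (Quotient.mk _ b) = Quotient.mk _ a ↔ TiltingCotilting.CotiltsTo b a) := by
  obtain ⟨e, he⟩ := TiltingCotilting.exists_equiv_of_rel (R := TiltingCotilting.Corresponds.{v})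
    TiltingCotilting.TiltingDatum.exists_corresponds
    TiltingCotilting.CotiltingDatum.exists_corresponds
    (fun h => ⟨h.of_equiv_left, h.equiv_left⟩) (fun h => ⟨h.of_equiv_right, h.equiv_right⟩)
  refine ⟨e, fun a b => (he a b).trans TiltingCotilting.tiltsTo_iff.symm, fun b a => ?_⟩
  rw [Equiv.symm_apply_eq, eq_comm]
  exact (he a b).trans TiltingCotilting.cotiltsTo_iff.symm
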